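/- **Setting.** Let $K<M$, $N\ge 0$ and $\tau_p\le\tau$ be natural numbers, and let $\beta_k>0$, $\bar\beta_k\ge0$, $\beta_{br}\ge0$, $\rho\ge0$, $\rho_u>0$, $P_R\ge0$, $\sigma_C^2>0$, $\eta_k\ge0$ ($k=1,\dots,K$) be real numbers. Write $\mathcal{CN}(0,v)$ for the circularly symmetric complex Gaussian law of variance $v$. A base station with $M$ antennas serves $K$ single-antenna users in the presence of a radar with $N$ transmit and $N$ receive antennas. The channel to user $k$ is $\mathbf g_k=\sqrt{\beta_k}\,\mathbf z_k\in\mathbb C^M$, and $\mathbf G=[\mathbf g_1,\dots,\mathbf g_K]$. The entries of the $\mathbf z_k$ have law $\mathcal{CN}(0,1)$, those of the channel $\mathbf R\in\mathbb C^{N\times M}$ to the radar have law $\mathcal{CN}(0,\beta_{br})$, those of the noise $\mathbf W\in\mathbb C^{M\times\tau_p}$ in the training phase have law $\mathcal{CN}(0,\sigma_C^2)$, and all these entries are mutually independent. The channel $\mathbf f_k\in\mathbb C^N$ from the radar to user $k$ has i.i.d. $\mathcal{CN}(0,\bar\beta_k)$ entries and is independent of the radar signal $\mathbf s\in\mathbb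 C^N$, which is square-integrable with $\mathbb E\{\mathbf s\mathbf s^H\}=\mathbf I_N$. The noise at user $k$ is $n_k\sim\mathcal{CN}(0,\sigma_C^2)$. In the training phase the base station receives $$\mathbf Y_p=\sqrt{\tau_pP_R}\,\mathbf R^H\boldsymbol\Phi_r^H+\sqrt{\tau_p\rho_u}\,\mathbf G\boldsymbol\Phi_p^H+\mathbf W,$$ where the pilots $\boldsymbol\Phi_r\in\mathbb C^{\tau_p\times N}$ and $\boldsymbol\Phi_p\in\mathbb C^{\tau_p\times K}$ satisfy $\boldsymbol\Phi_r^H\boldsymbol\Phi_r=\mathbf I_N$, $\boldsymbol\Phi_p^H\boldsymbol\Phi_p=\mathbf I_K$, $\boldsymbol\Phi_r^H\boldsymbol\Phi_p=\mathbf 0$. Let $\hat{\mathbf G}=[\hat{\mathbf g}_1,\dots,\hat{\mathbf g}_K]$ be the minimum mean-square error estimate of $\mathbf G$ from $\mathbf Y_p$, and put $$\gamma_k=\frac{\tau_p\rho_u\beta_k^2}{\tau_p\rho_u\beta_k+\sigma_C^2},\qquad \mathbf H=[\mathbf h_1,\dots,\mathbf h_K],\quad \mathbf h_k=\hat{\mathbf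 g}_k/\sqrt{\gamma_k}.$$ For a precoding matrix with columns $\mathbf t_1,\dots,\mathbf t_K$, the achievable (hardening-bound) spectral efficiency of user $k$ is $\mathrm{SE}_k=(1-\tau_p/\tau)\log_2(1+\mathrm{SINR}_k)$ with $$\mathrm{SINR}_k=\frac{|\mathrm{DS}_k|^2}{\mathbb E\{|\mathrm{BU}_k|^2\}+\sum_{k'\ne k}\mathbb E\{|\mathrm{IUI}_{kk'}|^2\}+\mathbb E\{|\sqrt{P_R}\,\mathbf f_k^T\mathbf s|^2\}+\mathbb E\{|n_k|^2\}},$$ where $\mathrm{DS}_k=\sqrt{\rho\eta_k}\,\mathbb E\{\mathbf g_k^T\mathbf t_k\}$, $\mathrm{BU}_k=\sqrt{\rho\eta_k}\,(\mathbf g_k^T\mathbf t_k-\mathbb E\{\mathbf g_k^T\mathbf t_k\})$ and $\mathrm{IUI}_{kk'}=\sqrt{\rho\eta_{k'}}\,\mathbf g_k^T\mathbf t_{k'}$. **Proposition.** Let $\mathbf t_k=\sqrt{M-K}\,\big[\mathbf H^*(\mathbf H^T\mathbf H^*)^{-1}\big]_{(:,k)}$ be the zero-forcing precoder. Then $\mathbf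 H^T\mathbf H^*$ is almost surely invertible, all the random variables $\mathbf g_k^T\mathbf t_{k'}$, $\sqrt{P_R}\,\mathbf f_k^T\mathbf s$ and $n_k$ are square-integrable, and for every $k$ $$\mathrm{SE}_k=\Big(1-\frac{\tau_p}{\tau}\Big)\log_2\left(1+\frac{(M-K)\rho\gamma_k\eta_k}{\rho(\beta_k-\gamma_k)\sum_{k'=1}^K\eta_{k'}+P_R\bar\beta_kN+\sigma_C^2}\right).$$ -/

import Mathlib

open MeasureTheory ProbabilityTheory Matrix

noncomputable section

namespace MassiveMIMORadar

/-- The circularly symmetric complex Gaussian law `CN(0, v)`: independent real and imaginary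
parts, each `N(0, v / 2)`. -/
def complexGaussian (v : ℝ) : Measure ℂ :=
  ((gaussianReal 0 (v / 2).toNNReal).prod (gaussianReal 0 (v / 2).toNNReal)).map
    Complex.measurableEquivRealProd.symm

/-- `Xhat` is a minimum mean-square error estimate of `X` from the observation `Y`: a
square-integrable measurable function of `Y` whose mean-square error is least among all
square-integrable measurable functions of `Y`. -/
def IsMMSEEstimate {Ω E : Type*} [MeasurableSpace Ω] [MeasurableSpace E] (P : Measure Ω)
    (X : Ω → ℂ) (Y : Ω → E) (Xhat : Ω → ℂ) : Prop :=
  (∃ φ : E → ℂ, Measurable φ ∧ ∀ ω, Xhat ω = φ (Y ω)) ∧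
  MemLp Xhat 2 P ∧
  ∀ ψ : E → ℂ, Measurable ψ → MemLp (fun ω => ψ (Y ω)) 2 P →
    ∫ ω, ‖X ω - Xhat ω‖ ^ 2 ∂P ≤ ∫ ω, ‖X ω - ψ (Y ω)‖ ^ 2 ∂P

/-- The deterministic parameters of the system with `K` users. -/
structure Params (K : ℕ) where
  /-- large-scale fading base station - user `k` -/
  β : Fin K → ℝ
  /-- large-scale fading radar - user `k` -/
  βbar : Fin K → ℝ
  /-- large-scale fading base station - radar -/
  βbr : ℝ
  /-- base station transmit power -/
  ρ : ℝ
  /-- user pilot power -/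
  ρu : ℝ
  /-- radar transmit power -/
  PR : ℝ
  /-- noise power `σ_C²` -/
  σC2 : ℝ
  /-- power control coefficients -/
  η : Fin K → ℝ
  β_pos : ∀ k, 0 < β k
  βbar_nonneg : ∀ k, 0 ≤ βbar k
  βbr_nonneg : 0 ≤ βbr
  ρ_nonneg : 0 ≤ ρ
  ρu_pos : 0 < ρu
  PR_nonneg : 0 ≤ PR
  σC2_pos : 0 < σC2
  η_nonneg : ∀ k, 0 ≤ η k

/-- `γ_k = τ_p ρ_u β_k² / (τ_p ρ_u β_k + σ_C²)`. -/
def Params.γ {K : ℕ} (p : Params K) (τp : ℕ) (k : Fin K) : ℝ :=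
  τp * p.ρu * p.β k ^ 2 / (τp * p.ρu * p.β k + p.σC2)

/-- The random quantities of one coherence interval: an `M`-antenna base station, `K` users, a
radar with `N` transmit and `N` receive antennas, pilots of `τp` symbols. -/
structure Model {Ω : Type*} [MeasurableSpace Ω] (P : Measure Ω) (M K N τp : ℕ)
    (p : Params K) where
  /-- small-scale fading base station - users, column `k` is `z_k` -/
  Z : Ω → Matrix (Fin M) (Fin K) ℂ
  /-- channel base station - radar receiver -/
  R : Ω → Matrix (Fin N) (Fin M) ℂ
  /-- noise at the base station during training -/
  W : Ω → Matrix (Fin M) (Fin τp) ℂ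
  /-- channel radar transmitter - users, column `k` is `f_k` -/
  F : Ω → Matrix (Fin N) (Fin K) ℂ
  /-- radar probing signal -/
  s : Ω → Fin N → ℂ
  /-- noise at the users -/
  n : Ω → Fin K → ℂ
  /-- radar pilots -/
  Φr : Matrix (Fin τp) (Fin N) ℂ
  /-- user pilots -/
  Φp : Matrix (Fin τp) (Fin K) ℂ
  hasLaw_Z : ∀ m k, HasLaw (fun ω => Z ω m k) (complexGaussian 1) P
  hasLaw_R : ∀ i m, HasLaw (fun ω => R ω i m) (complexGaussian p.βbr) P
  hasLaw_W : ∀ m t, HasLaw (fun ω => W ω m t) (complexGaussian p.σC2) P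
  hasLaw_F : ∀ i k, HasLaw (fun ω => F ω i k) (complexGaussian (p.βbar k)) P
  hasLaw_n : ∀ k, HasLaw (fun ω => n ω k) (complexGaussian p.σC2) P
  /-- all entries of `Z`, `R` and `W` are mutually independent -/
  indep_ZRW : iIndepFun
    (fun (j : (Fin M × Fin K) ⊕ (Fin N × Fin M) ⊕ (Fin M × Fin τp)) ω =>
      Sum.elim (fun a => Z ω a.1 a.2)
        (Sum.elim (fun a => R ω a.1 a.2) (fun a => W ω a.1 a.2)) j) P
  /-- the entries of `f_k` are mutually independent -/
  indep_F : ∀ k, iIndepFun (fun (i : Fin N) ω => F ω i k) P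
  /-- the probing signal is independent of `f_k` -/
  indep_F_s : ∀ k, IndepFun (fun ω (i : Fin N) => F ω i k) s P
  memLp_s : ∀ i, MemLp (fun ω => s ω i) 2 P
  /-- `E{s s^H} = I_N` -/
  cov_s : ∀ i j, ∫ ω, s ω i * star (s ω j) ∂P = if i = j then 1 else 0
  Φr_orthonormal : Φrᴴ * Φr = 1
  Φp_orthonormal : Φpᴴ * Φp = 1
  Φr_Φp_orthogonal : Φrᴴ * Φp = 0

namespace Model

variable {Ω : Type*} [MeasurableSpace Ω] {P : Measure Ω} {M K N τp : ℕ} {p : Params K}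

/-- The channel matrix `G`, with columns `g_k = √β_k z_k`. -/
def G (S : Model P M K N τp p) (ω : Ω) : Matrix (Fin M) (Fin K) ℂ :=
  Matrix.of fun m k => (√(p.β k) : ℂ) * S.Z ω m k

/-- The received pilot signal
`Y_p = √(τ_p P_R) R^H Φ_r^H + √(τ_p ρ_u) G Φ_p^H + W`. -/
def Y (S : Model P M K N τp p) (ω : Ω) : Matrix (Fin M) (Fin τp) ℂ :=
  (√(τp * p.PR) : ℂ) • ((S.R ω)ᴴ * S.Φrᴴ) + (√(τp * p.ρu) : ℂ) • (S.G ω * S.Φpᴴ) + S.W ω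

/-- `Ghat` is the MMSE estimate of `G` from the received pilot signal, entry by entry. -/
def IsChannelEstimate (S : Model P M K N τp p) (Ghat : Ω → Matrix (Fin M) (Fin K) ℂ) : Prop :=
  ∀ m k, IsMMSEEstimate P (fun ω => S.G ω m k)
    (fun ω (i : Fin M) (t : Fin τp) => S.Y ω i t) (fun ω => Ghat ω m k)

end Model

/-- The matrix `H` with columns `h_k = ĝ_k / √γ_k`, so that `Ĝ = H D_γ^{1/2}`. -/
def normalizedEstimate {M K : ℕ} (γ : Fin K → ℝ) (Ghat : Matrix (Fin M) (Fin K) ℂ) :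
    Matrix (Fin M) (Fin K) ℂ :=
  Matrix.of fun m k => Ghat m k / (√(γ k) : ℂ)

/-- The zero-forcing precoding matrix `√(M - K) H^* (H^T H^*)⁻¹`; its column `k` is `t_k`. -/
def zfPrecoder {M K : ℕ} (H : Matrix (Fin M) (Fin K) ℂ) : Matrix (Fin M) (Fin K) ℂ :=
  (√((M : ℝ) - K) : ℂ) • (H.map star * (Hᵀ * H.map star)⁻¹)

namespace Model

variable {Ω : Type*} [MeasurableSpace Ω] {P : Measure Ω} {M K N τp : ℕ} {p : Params K}

/-- The effective gain `g_k^T t_{k'}` for a random precoding matrix `T`. -/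
def gain (S : Model P M K N τp p) (T : Ω → Matrix (Fin M) (Fin K) ℂ) (k k' : Fin K) (ω : Ω) : ℂ :=
  ((S.G ω)ᵀ * T ω) k k'

/-- Desired signal strength. -/
def DS (S : Model P M K N τp p) (T : Ω → Matrix (Fin M) (Fin K) ℂ) (k : Fin K) : ℂ :=
  (√(p.ρ * p.η k) : ℂ) * ∫ ω, S.gain T k k ω ∂P

/-- Beamforming gain uncertainty. -/
def BU (S : Model P M K N τp p) (T : Ω → Matrix (Fin M) (Fin K) ℂ) (k : Fin K) (ω : Ω) : ℂ :=
  (√(p.ρ * p.η k) : ℂ) * (S.gain T k k ω - ∫ ω', S.gain T k k ω' ∂P)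

/-- Interference at user `k` caused by the signal of user `k'`. -/
def IUI (S : Model P M K N τp p) (T : Ω → Matrix (Fin M) (Fin K) ℂ) (k k' : Fin K) (ω : Ω) : ℂ :=
  (√(p.ρ * p.η k') : ℂ) * S.gain T k k' ω

/-- Interference `√P_R f_k^T s` at user `k` caused by the radar. -/
def radarInterference (S : Model P M K N τp p) (k : Fin K) (ω : Ω) : ℂ :=
  (√p.PR : ℂ) * ∑ i, S.F ω i k * S.s ω i

/-- The effective SINR of user `k`: the power of the desired signal over the total power of
beamforming uncertainty, inter-user interference, radar interference and noise. -/
def SINR (S : Model P M K N τp p) (T : Ω → Matrix (Fin M) (Fin K) ℂ) (k : Fin K) : ℝ :=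
  ‖S.DS T k‖ ^ 2 /
    (∫ ω, ‖S.BU T k ω‖ ^ 2 ∂P + ∑ k' ∈ Finset.univ.erase k, ∫ ω, ‖S.IUI T k k' ω‖ ^ 2 ∂P
      + ∫ ω, ‖S.radarInterference k ω‖ ^ 2 ∂P + ∫ ω, ‖S.n ω k‖ ^ 2 ∂P)

/-- The achievable downlink SE of user `k` with coherence interval `τ`. -/
def SE (S : Model P M K N τp p) (τ : ℕ) (T : Ω → Matrix (Fin M) (Fin K) ℂ) (k : Fin K) : ℝ :=
  (1 - (τp : ℝ) / τ) * Real.logb 2 (1 + S.SINR T k)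

end Model

end MassiveMIMORadar

end

/-! Everything rests on a decomposition `g_k = √γ_k h_k + e_k` in which the error is independent of
the whole pilot observation. Multiplying `Y_p` by `Φp` removes the radar and separates the users,
leaving a scaled copy of each channel entry plus noise. With the right gain (`Params.filterGain`)
the residual is uncorrelated with every entry of `Y_p`. All these variables are linear forms in
independent circular Gaussians, so uncorrelated means independent (`indepFun_linearForms`). By
Pythagoras every MMSE estimate then agrees almost surely with the linear one
(`IsMMSEEstimate.ae_eq`), and `H` has i.i.d. `CN(0,1)` entries.

Zero forcing gives `h_kᵀ t_k' = √(M-K) δ_kk'`, so the gain `g_kᵀ t_k'` is the constant `√((M-K)γ_k)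
δ_kk'` plus `e_kᵀ t_k'` (`ae_gain_eq`). The precoder is a function of `Y_p`, hence independent of
`e_k`. The error term therefore has mean zero and second moment `(β_k - γ_k) E‖t_k'‖²`, and the
claim reduces to `E‖t_k'‖² = 1`.

With `B = H^*` this says that the diagonal entries of `(BᴴB)⁻¹` have mean `1/(M-K)`
(`lintegral_gram_inv_apply`). By the Schur complement such an entry is `1/(bᴴQb)`, where `b` is one
column of `B` and `Q` projects onto the complement of the other `K-1` columns, which are independent
of `b`. Writing `1/x = ∫₀^∞ exp(-sx) ds` and diagonalizing `Q`, of rank `n = M-K+1`, turns the mean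
into `∫₀^∞ (1+s)⁻ⁿ ds = 1/(n-1)` (`lintegral_inv_quadForm`). As this is computed in `[0,∞]`, its
finiteness also shows that `bᴴQb` is almost surely nonzero; adding columns one at a time gives
almost sure invertibility of the Gram matrix. -/

noncomputable section

namespace MassiveMIMORadar

open scoped ComplexConjugate

/-! ### Moments of the circularly symmetric complex Gaussian law. -/

section ComplexGaussian

lemma complexGaussian_eq_map (v : ℝ) :
    complexGaussian v =
      ((gaussianReal 0 (v / 2).toNNReal).prod (gaussianReal 0 (v / 2).toNNReal)).map
        Complex.equivRealProdCLM.symm := rfl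

instance isGaussian_complexGaussian (v : ℝ) : IsGaussian (complexGaussian v) := by
  rw [complexGaussian_eq_map]
  infer_instance

/-- The law is a product measure in real coordinates, so this reduces the moments and Laplace
transforms below to one real Gaussian. -/
lemma integral_re_mul_im_complexGaussian (v : ℝ) (f g : ℝ → ℝ) (hf : Continuous f)
    (hg : Continuous g) :
    ∫ z, f z.re * g z.im ∂complexGaussian v =
      (∫ x, f x ∂gaussianReal 0 (v / 2).toNNReal) *
        ∫ x, g x ∂gaussianReal 0 (v / 2).toNNReal := by
  rw [complexGaussian_eq_map, integral_map, ← integral_prod_mul]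
  · rfl
  · fun_prop
  · exact Continuous.aestronglyMeasurable (by fun_prop)

lemma integral_sq_gaussianReal (w : NNReal) : ∫ x, x ^ 2 ∂gaussianReal 0 w = w := by
  have h := variance_fun_id_gaussianReal (μ := 0) (v := w)
  rw [variance_eq_integral (by fun_prop)] at h
  simpa using h

lemma memLp_id_complexGaussian (v : ℝ) : MemLp (fun z : ℂ => z) 2 (complexGaussian v) :=
  IsGaussian.memLp_id _ 2 (by simp)

lemma integrable_re_sq_complexGaussian (v : ℝ) :
    Integrable (fun z : ℂ => z.re ^ 2) (complexGaussian v) :=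
  (memLp_id_complexGaussian v).re.integrable_sq

lemma integrable_im_sq_complexGaussian (v : ℝ) :
    Integrable (fun z : ℂ => z.im ^ 2) (complexGaussian v) :=
  (memLp_id_complexGaussian v).im.integrable_sq

lemma integral_re_sq_complexGaussian {v : ℝ} (hv : 0 ≤ v) :
    ∫ z, z.re ^ 2 ∂complexGaussian v = v / 2 := by
  have := integral_re_mul_im_complexGaussian v (fun x => x ^ 2) (fun _ => 1) (by fun_prop)
    (by fun_prop)
  simpa [integral_sq_gaussianReal, max_eq_left (show 0 ≤ v / 2 by positivity)] using this

lemma integral_im_sq_complexGaussian {v : ℝ} (hv : 0 ≤ v) :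
    ∫ z, z.im ^ 2 ∂complexGaussian v = v / 2 := by
  have := integral_re_mul_im_complexGaussian v (fun _ => 1) (fun x => x ^ 2) (by fun_prop)
    (by fun_prop)
  simpa [integral_sq_gaussianReal, max_eq_left (show 0 ≤ v / 2 by positivity)] using this

lemma integral_re_mul_im_complexGaussian_eq_zero (v : ℝ) :
    ∫ z, z.re * z.im ∂complexGaussian v = 0 := by
  have := integral_re_mul_im_complexGaussian v (fun x => x) (fun x => x) (by fun_prop)
    (by fun_prop)
  simpa using this

lemma integral_id_complexGaussian (v : ℝ) : ∫ z, z ∂complexGaussian v = 0 := by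
  have hi : Integrable (fun z : ℂ => z) (complexGaussian v) :=
    (memLp_id_complexGaussian v).integrable (by norm_num)
  have h1 := integral_re_mul_im_complexGaussian v (fun x => x) (fun _ => 1) (by fun_prop)
    (by fun_prop)
  have h2 := integral_re_mul_im_complexGaussian v (fun _ => 1) (fun x => x) (by fun_prop)
    (by fun_prop)
  simp at h1 h2
  have h3 := integral_re_add_im hi
  simp only [RCLike.re_to_complex, RCLike.im_to_complex] at h3
  rw [← h3, h1, h2]
  simp

/-- The real and imaginary parts have equal variance and are uncorrelated, so `z²` averages to zero.
This vanishing pseudo-variance is the form in which circular symmetry is used later. -/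
lemma integral_mul_self_complexGaussian {v : ℝ} (hv : 0 ≤ v) :
    ∫ z, z * z ∂complexGaussian v = 0 := by
  have hi : Integrable (fun z : ℂ => z * z) (complexGaussian v) :=
    (memLp_id_complexGaussian v).integrable_mul (memLp_id_complexGaussian v)
  have h3 := integral_re_add_im hi
  simp only [RCLike.re_to_complex, RCLike.im_to_complex, Complex.mul_re, Complex.mul_im] at h3
  have h4 : ∫ z : ℂ, (z.re * z.re - z.im * z.im) ∂complexGaussian v = 0 := by
    simp_rw [← pow_two]
    rw [integral_sub (integrable_re_sq_complexGaussian v) (integrable_im_sq_complexGaussian v),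
      integral_re_sq_complexGaussian hv, integral_im_sq_complexGaussian hv, sub_self]
  have h5 : ∫ z : ℂ, (z.re * z.im + z.im * z.re) ∂complexGaussian v = 0 := by
    have : ∀ z : ℂ, z.re * z.im + z.im * z.re = 2 * (z.re * z.im) := fun z => by ring
    simp_rw [this]
    rw [integral_const_mul, integral_re_mul_im_complexGaussian_eq_zero, mul_zero]
  rw [← h3, h4, h5]
  simp

lemma integral_mul_conj_complexGaussian {v : ℝ} (hv : 0 ≤ v) :
    ∫ z, z * conj z ∂complexGaussian v = v := by
  have h : ∀ z : ℂ, z * conj z = ((z.re ^ 2 + z.im ^ 2 : ℝ) : ℂ) := fun z => by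
    rw [Complex.mul_conj, Complex.normSq_apply]; push_cast; ring
  simp_rw [h]
  rw [integral_complex_ofReal, integral_add (integrable_re_sq_complexGaussian v)
    (integrable_im_sq_complexGaussian v),
      integral_re_sq_complexGaussian hv, integral_im_sq_complexGaussian hv]
  norm_num

end ComplexGaussian

/-! ### Laws and independence of linear forms in independent circular Gaussians. -/

section LinearForms

variable {Ω : Type*} [MeasurableSpace Ω] {P : Measure Ω}

/-- The real covariance of real parts of centred complex variables. -/
lemma covariance_re_re [IsProbabilityMeasure P] {U V : Ω → ℂ} (hU : MemLp U 2 P)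
    (hV : MemLp V 2 P) (hU0 : ∫ ω, U ω ∂P = 0) (hUV : ∫ ω, U ω * V ω ∂P = 0) :
    cov[fun ω => (U ω).re, fun ω => (V ω).re; P] = (∫ ω, U ω * conj (V ω) ∂P).re / 2 := by
  have hi : Integrable (fun ω => U ω * V ω) P := hU.integrable_mul hV
  have hi' : Integrable (fun ω => U ω * conj (V ω)) P := hU.integrable_mul hV.star
  change cov[fun ω => RCLike.re (U ω), fun ω => RCLike.re (V ω); P] = _
  rw [covariance_eq_sub hU.re hV.re]
  have h0 : ∫ ω, RCLike.re (U ω) ∂P = 0 := by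
    rw [integral_re (hU.integrable (by norm_num)), hU0]; simp
  -- `Re U · Re V = Re (UV + U conj V) / 2`; the first summand is the pseudo-covariance, which
  -- vanishes by `hUV`.
  have h1 : ∫ ω, ((fun ω => RCLike.re (U ω)) * fun ω => RCLike.re (V ω)) ω ∂P =
      ((∫ ω, U ω * V ω ∂P) + ∫ ω, U ω * conj (V ω) ∂P).re / 2 := by
    have h := integral_re (hi.add hi')
    simp only [Pi.add_apply] at h
    rw [← integral_add hi hi', ← RCLike.re_to_complex, ← h, ← integral_div]
    congr 1; ext ω
    simp
  rw [h1, h0, hUV]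
  simp

/-- The real pairing of `t` with `V` is `Re (conj t · V)`, a centred real Gaussian of variance `‖t‖²
w / 2`. Thus the law depends on `w` alone, and two circular Gaussians with the same `w` can be
identified. -/
lemma charFun_map_of_circular {V : Ω → ℂ} (hV : HasGaussianLaw V P) {w : ℝ}
    (h0 : ∫ ω, V ω ∂P = 0) (h1 : ∫ ω, V ω * V ω ∂P = 0) (h2 : ∫ ω, V ω * conj (V ω) ∂P = w)
    (t : ℂ) : charFun (P.map V) t = Complex.exp (-((‖t‖ ^ 2 * w / 2 : ℝ) : ℂ) / 2) := by
  have := hV.isProbabilityMeasure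
  have hm : MemLp V 2 P := hV.memLp_two
  have hi : ∀ z : ℂ, inner ℝ t z = (conj t * z).re := fun z => by
    rw [Complex.inner, mul_comm]
  rw [hV.charFun_map_eq]
  simp_rw [hi]
  have e0 : ∫ ω, (conj t * V ω).re ∂P = 0 := by
    have := integral_re ((hm.integrable (by norm_num : (1 : ENNReal) ≤ 2)).const_mul (conj t))
    simp only [RCLike.re_to_complex] at this
    rw [this, integral_const_mul, h0]; simp
  have hm' : MemLp (fun ω => conj t * V ω) 2 P := hm.const_mul _
  have e1 : Var[fun ω => (conj t * V ω).re; P] = ‖t‖ ^ 2 * w / 2 := by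
    have hre : AEMeasurable (fun ω => (conj t * V ω).re) P := hm'.re.aemeasurable
    rw [← covariance_self hre, covariance_re_re hm' hm']
    · have : ∀ ω, conj t * V ω * conj (conj t * V ω) =
          ((‖t‖ ^ 2 : ℝ) : ℂ) * (V ω * conj (V ω)) := fun ω => by
        push_cast
        rw [← Complex.conj_mul']
        simp; ring
      simp_rw [this]
      rw [integral_const_mul, h2, ← Complex.ofReal_mul, Complex.ofReal_re]
    · rw [integral_const_mul, h0, mul_zero]
    · have : ∀ ω, conj t * V ω * (conj t * V ω) = conj t ^ 2 * (V ω * V ω) := fun ω => by ring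
      simp_rw [this]
      rw [integral_const_mul, h1, mul_zero]
  rw [e0, e1]
  congr 1
  push_cast; ring

/-- A centred complex Gaussian variable with vanishing pseudo-variance is circularly symmetric. -/
lemma hasLaw_complexGaussian_of_circular {U : Ω → ℂ} (hU : HasGaussianLaw U P) {w : ℝ}
    (hw : 0 ≤ w) (h0 : ∫ ω, U ω ∂P = 0) (h1 : ∫ ω, U ω * U ω ∂P = 0)
    (h2 : ∫ ω, U ω * conj (U ω) ∂P = w) : HasLaw U (complexGaussian w) P := by
  have := hU.isProbabilityMeasure
  refine ⟨hU.aemeasurable, ?_⟩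
  have : IsProbabilityMeasure (P.map U) := hU.isGaussian_map.toIsProbabilityMeasure
  refine Measure.ext_of_charFun (funext fun t => ?_)
  rw [charFun_map_of_circular hU h0 h1 h2]
  have h := charFun_map_of_circular (P := complexGaussian w) (V := fun z => z)
    IsGaussian.hasGaussianLaw_id
    (integral_id_complexGaussian w) (integral_mul_self_complexGaussian hw)
    (integral_mul_conj_complexGaussian hw) t
  rw [← h, Measure.map_id']

section Law

variable {X : Ω → ℂ} {v : ℝ}

lemma memLp_of_hasLaw (hX : HasLaw X (complexGaussian v) P) : MemLp X 2 P :=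
  hX.hasGaussianLaw.memLp_two

lemma integral_of_hasLaw (hX : HasLaw X (complexGaussian v) P) : ∫ ω, X ω ∂P = 0 := by
  rw [hX.integral_eq, integral_id_complexGaussian]

lemma integral_mul_self_of_hasLaw (hX : HasLaw X (complexGaussian v) P) (hv : 0 ≤ v) :
    ∫ ω, X ω * X ω ∂P = 0 := by
  rw [← integral_mul_self_complexGaussian hv]
  exact hX.integral_comp (f := fun z => z * z) (Continuous.aestronglyMeasurable (by fun_prop))

lemma integral_mul_conj_of_hasLaw (hX : HasLaw X (complexGaussian v) P) (hv : 0 ≤ v) :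
    ∫ ω, X ω * conj (X ω) ∂P = v := by
  rw [← integral_mul_conj_complexGaussian hv]
  exact hX.integral_comp (f := fun z => z * conj z) (Continuous.aestronglyMeasurable (by fun_prop))

/-- Conjugation preserves all the data that determine a circular law. It is needed because `R`
enters the pilot signal through `Rᴴ`, and because the precoder is built from `H^*`. -/
lemma hasLaw_conj (hX : HasLaw X (complexGaussian v) P) (hv : 0 ≤ v) :
    HasLaw (fun ω => conj (X ω)) (complexGaussian v) P := by
  refine hasLaw_complexGaussian_of_circular
    (hX.hasGaussianLaw.map_fun Complex.conjCLE.toContinuousLinearMap) hv ?_ ?_ ?_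
  · change ∫ ω, conj (X ω) ∂P = 0
    rw [integral_conj, integral_of_hasLaw hX, map_zero]
  · change ∫ ω, conj (X ω) * conj (X ω) ∂P = 0
    simp_rw [← map_mul]
    rw [integral_conj, integral_mul_self_of_hasLaw hX hv, map_zero]
  · change ∫ ω, conj (X ω) * conj (conj (X ω)) ∂P = v
    simp_rw [← map_mul]
    rw [integral_conj, integral_mul_conj_of_hasLaw hX hv, Complex.conj_ofReal]

end Law

variable {J : Type*} [Fintype J] {X : J → Ω → ℂ} {v : J → ℝ}

lemma memLp_linearForm (hX : ∀ j, HasLaw (X j) (complexGaussian (v j)) P) (a : J → ℂ) :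
    MemLp (fun ω => ∑ j, a j * X j ω) 2 P :=
  memLp_finsetSum _ fun j _ => (memLp_of_hasLaw (hX j)).const_mul (a j)

lemma integral_linearForm [IsProbabilityMeasure P]
    (hX : ∀ j, HasLaw (X j) (complexGaussian (v j)) P) (a : J → ℂ) :
    ∫ ω, ∑ j, a j * X j ω ∂P = 0 := by
  rw [integral_finsetSum]
  · simp_rw [integral_const_mul, integral_of_hasLaw (hX _), mul_zero, Finset.sum_const_zero]
  · exact fun j _ => ((memLp_of_hasLaw (hX j)).const_mul (a j)).integrable (by norm_num)

/-- Diagonal terms vanish by circularity, the others by independence and zero mean. Hence linear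
forms are jointly circular, and their Hermitian covariances determine all real covariances. -/
lemma integral_linearForm_mul (hX : ∀ j, HasLaw (X j) (complexGaussian (v j)) P)
    (hv : ∀ j, 0 ≤ v j) (hI : iIndepFun X P) (a b : J → ℂ) :
    ∫ ω, (∑ j, a j * X j ω) * (∑ j, b j * X j ω) ∂P = 0 := by
  classical
  have hm := fun j => memLp_of_hasLaw (hX j)
  simp_rw [Finset.sum_mul_sum]
  have h_int : ∀ i j, Integrable (fun ω => a i * X i ω * (b j * X j ω)) P := fun i j =>
    ((hm i).const_mul (a i)).integrable_mul ((hm j).const_mul (b j))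
  rw [integral_finsetSum _ fun i _ => integrable_finsetSum _ fun j _ => h_int i j]
  refine Finset.sum_eq_zero fun i _ => ?_
  rw [integral_finsetSum _ fun j _ => h_int i j]
  refine Finset.sum_eq_zero fun j _ => ?_
  have e : ∀ ω, a i * X i ω * (b j * X j ω) = a i * b j * (X i ω * X j ω) := fun ω => by ring
  simp_rw [e]
  rw [integral_const_mul]
  by_cases hij : i = j
  · subst hij
    rw [integral_mul_self_of_hasLaw (hX i) (hv i), mul_zero]
  · rw [(hI.indepFun hij).integral_fun_mul_eq_mul_integral (hm i).aestronglyMeasurable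
      (hm j).aestronglyMeasurable, integral_of_hasLaw (hX i)]
    simp

lemma integral_linearForm_mul_conj (hX : ∀ j, HasLaw (X j) (complexGaussian (v j)) P)
    (hv : ∀ j, 0 ≤ v j) (hI : iIndepFun X P) (a b : J → ℂ) :
    ∫ ω, (∑ j, a j * X j ω) * conj (∑ j, b j * X j ω) ∂P = ∑ j, a j * conj (b j) * v j := by
  classical
  have hm := fun j => memLp_of_hasLaw (hX j)
  have hm' : ∀ j, MemLp (fun ω => conj (X j ω)) 2 P := fun j => (hm j).star
  simp_rw [map_sum, map_mul, Finset.sum_mul_sum]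
  have h_int : ∀ i j, Integrable (fun ω => a i * X i ω * (conj (b j) * conj (X j ω))) P :=
    fun i j => ((hm i).const_mul (a i)).integrable_mul ((hm' j).const_mul (conj (b j)))
  rw [integral_finsetSum _ fun i _ => integrable_finsetSum _ fun j _ => h_int i j]
  refine Finset.sum_congr rfl fun i _ => ?_
  rw [integral_finsetSum _ fun j _ => h_int i j]
  have e : ∀ j ω, a i * X i ω * (conj (b j) * conj (X j ω)) =
      a i * conj (b j) * (X i ω * conj (X j ω)) := fun j ω => by ring
  simp_rw [e, integral_const_mul]
  rw [Finset.sum_eq_single i]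
  · rw [integral_mul_conj_of_hasLaw (hX i) (hv i)]
  · intro j _ hji
    have hc : IndepFun (X i) (fun ω => conj (X j ω)) P :=
      (hI.indepFun hji.symm).comp measurable_id (Complex.continuous_conj.measurable)
    rw [hc.integral_fun_mul_eq_mul_integral (hm i).aestronglyMeasurable
      (hm' j).aestronglyMeasurable, integral_of_hasLaw (hX i)]
    simp
  · simp

variable {ι κ : Type*}

/-- The linear forms with coefficient matrix `A`, as a real-linear map. -/
def linearFormCLM (A : Matrix ι J ℂ) : (J → ℂ) →L[ℝ] (ι → ℂ) :=
  LinearMap.toContinuousLinearMap (A.mulVecLin.restrictScalars ℝ)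

variable [Fintype ι] [Fintype κ]

lemma hasGaussianLaw_pi (hX : ∀ j, HasLaw (X j) (complexGaussian (v j)) P)
    (hI : iIndepFun X P) : HasGaussianLaw (fun ω j => X j ω) P :=
  hI.hasGaussianLaw fun j => (hX j).hasGaussianLaw

lemma hasGaussianLaw_linearForms (hX : ∀ j, HasLaw (X j) (complexGaussian (v j)) P)
    (hI : iIndepFun X P) (A : Matrix ι J ℂ) :
    HasGaussianLaw (fun ω i => ∑ j, A i j * X j ω) P :=
  (hasGaussianLaw_pi hX hI).map_fun (linearFormCLM A)

lemma hasLaw_linearForm (hX : ∀ j, HasLaw (X j) (complexGaussian (v j)) P)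
    (hv : ∀ j, 0 ≤ v j) (hI : iIndepFun X P) (a : J → ℂ) {w : ℝ}
    (hw : ∑ j, a j * conj (a j) * v j = w) :
    HasLaw (fun ω => ∑ j, a j * X j ω) (complexGaussian w) P := by
  have := hI.isProbabilityMeasure
  -- `complexGaussian` truncates negative variances to zero, so the sign of `w` has to be known; it
  -- comes from `w = ∑ ‖a j‖² v j`.
  have hw0 : 0 ≤ w := by
    have : w = ∑ j, ‖a j‖ ^ 2 * v j := by
      have h : ((∑ j, ‖a j‖ ^ 2 * v j : ℝ) : ℂ) = w := by
        rw [← hw]; push_cast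
        simp_rw [Complex.mul_conj']
      exact_mod_cast h.symm
    rw [this]
    exact Finset.sum_nonneg fun j _ => mul_nonneg (by positivity) (hv j)
  refine hasLaw_complexGaussian_of_circular
    ((hasGaussianLaw_linearForms hX hI (Matrix.of fun (_ : Unit) => a)).eval ()) hw0
    (integral_linearForm hX a) (integral_linearForm_mul hX hv hI a a) ?_
  rw [← hw]
  exact integral_linearForm_mul_conj hX hv hI a a

/-- A real-linear functional is the real part of a complex-linear one, with coefficients `L(e_i) - i
L(i e_i)`. The Gaussian independence criterion tests real functionals, and this brings them back to
complex linear forms. -/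
lemma exists_forall_strongDual_eq_re (L : StrongDual ℝ (ι → ℂ)) :
    ∃ a : ι → ℂ, ∀ x, L x = (∑ i, a i * x i).re := by
  classical
  refine ⟨fun i => (L (Pi.single i 1) : ℂ) - L (Pi.single i Complex.I) * Complex.I, fun x => ?_⟩
  have hx : x = ∑ i, ((x i).re • (Pi.single i 1 : ι → ℂ) +
      (x i).im • (Pi.single i Complex.I : ι → ℂ)) := by
    ext i
    simp [Finset.sum_apply, Pi.single_apply, Finset.sum_add_distrib, Complex.re_add_im]
  conv_lhs => rw [hx]
  simp only [map_sum, map_add, map_smul, smul_eq_mul, Complex.re_sum]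
  refine Finset.sum_congr rfl fun i _ => ?_
  simp
  ring

lemma covariance_re_linearForm (hX : ∀ j, HasLaw (X j) (complexGaussian (v j)) P)
    (hv : ∀ j, 0 ≤ v j) (hI : iIndepFun X P) (a b : J → ℂ) :
    cov[fun ω => (∑ j, a j * X j ω).re, fun ω => (∑ j, b j * X j ω).re; P] =
      (∑ j, a j * conj (b j) * v j).re / 2 := by
  have := hI.isProbabilityMeasure
  rw [covariance_re_re (memLp_linearForm hX a) (memLp_linearForm hX b) (integral_linearForm hX a)
    (integral_linearForm_mul hX hv hI a b), integral_linearForm_mul_conj hX hv hI]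

/-- Uncorrelated families of linear forms in independent circularly symmetric Gaussian variables
are independent. -/
lemma indepFun_linearForms (hX : ∀ j, HasLaw (X j) (complexGaussian (v j)) P)
    (hv : ∀ j, 0 ≤ v j) (hI : iIndepFun X P) (A : Matrix ι J ℂ) (B : Matrix κ J ℂ)
    (hAB : ∀ i k, ∑ j, A i j * conj (B k j) * v j = 0) :
    IndepFun (fun ω i => ∑ j, A i j * X j ω) (fun ω k => ∑ j, B k j * X j ω) P := by
  have hG : HasGaussianLaw
      (fun ω => ((fun i => ∑ j, A i j * X j ω), (fun k => ∑ j, B k j * X j ω))) P :=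
    (hasGaussianLaw_pi hX hI).map_fun ((linearFormCLM A).prod (linearFormCLM B))
  refine hG.indepFun_of_covariance_strongDual fun L₁ L₂ => ?_
  obtain ⟨a, ha⟩ := exists_forall_strongDual_eq_re L₁
  obtain ⟨b, hb⟩ := exists_forall_strongDual_eq_re L₂
  have e1 : (L₁ ∘ fun ω i => ∑ j, A i j * X j ω) =
      fun ω => (∑ j, (∑ i, a i * A i j) * X j ω).re := by
    ext ω
    simp only [Function.comp, ha, Finset.mul_sum, Finset.sum_mul]
    rw [Finset.sum_comm]
    simp_rw [mul_assoc]
  have e2 : (L₂ ∘ fun ω i => ∑ j, B i j * X j ω) =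
      fun ω => (∑ j, (∑ i, b i * B i j) * X j ω).re := by
    ext ω
    simp only [Function.comp, hb, Finset.mul_sum, Finset.sum_mul]
    rw [Finset.sum_comm]
    simp_rw [mul_assoc]
  rw [e1, e2, covariance_re_linearForm hX hv hI]
  have : ∑ j, (∑ i, a i * A i j) * conj (∑ i, b i * B i j) * v j =
      ∑ i, ∑ k, a i * conj (b k) * ∑ j, A i j * conj (B k j) * v j := by
    simp_rw [map_sum, Finset.sum_mul_sum, Finset.sum_mul, Finset.mul_sum]
    rw [Finset.sum_comm]
    refine Finset.sum_congr rfl fun i _ => ?_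
    rw [Finset.sum_comm]
    refine Finset.sum_congr rfl fun k _ => Finset.sum_congr rfl fun j _ => ?_
    simp; ring
  rw [this]
  simp [hAB]

/-- The forms are jointly Gaussian, so pairwise vanishing covariances already give mutual
independence. Testing against `x` and `y` only multiplies the Hermitian covariance by `conj x · y`.
-/
lemma iIndepFun_linearForms (hX : ∀ j, HasLaw (X j) (complexGaussian (v j)) P)
    (hv : ∀ j, 0 ≤ v j) (hI : iIndepFun X P) (A : Matrix ι J ℂ)
    (hA : ∀ i k, i ≠ k → ∑ j, A i j * conj (A k j) * v j = 0) :
    iIndepFun (fun i ω => ∑ j, A i j * X j ω) P := by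
  refine (hasGaussianLaw_linearForms hX hI A).iIndepFun_of_covariance_inner fun i k hik x y => ?_
  have e : ∀ (x : ℂ) i ω, inner ℝ x (∑ j, A i j * X j ω) = (∑ j, (conj x * A i j) * X j ω).re := by
    intro x i ω
    rw [Complex.inner, mul_comm, Finset.mul_sum]
    simp_rw [mul_assoc]
  simp_rw [e]
  rw [covariance_re_linearForm hX hv hI]
  have : ∑ j, conj x * A i j * conj (conj y * A k j) * v j =
      conj x * y * ∑ j, A i j * conj (A k j) * v j := by
    rw [Finset.mul_sum]
    refine Finset.sum_congr rfl fun j _ => ?_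
    simp; ring
  rw [this, hA i k hik]
  simp

end LinearForms

/-! ### Inverse moments of Gaussian quadratic forms given by projections. -/

section InverseMoment

/-- Variance `1/2` makes the density `exp(-x²)/√π`, so the integrand is a Gaussian with exponent
`-(1+s)x²`. -/
lemma integral_exp_neg_mul_sq_gaussianReal {s : ℝ} (hs : 0 ≤ s) :
    ∫ x, Real.exp (-s * x ^ 2) ∂gaussianReal 0 (1 / 2 : ℝ).toNNReal = (√(1 + s))⁻¹ := by
  have h2 : ((1 / 2 : ℝ).toNNReal : ℝ) = 1 / 2 := Real.coe_toNNReal _ (by norm_num)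
  rw [integral_gaussianReal_eq_integral_smul (by simp)]
  simp only [gaussianPDFReal, h2, smul_eq_mul, mul_assoc, ← Real.exp_add]
  have e : ∀ x : ℝ, -(x - 0) ^ 2 / (2 * (1 / 2)) + -(s * x ^ 2) = -(1 + s) * x ^ 2 := fun x => by
    ring
  simp_rw [neg_mul s, e]
  rw [integral_const_mul, integral_gaussian, ← Real.sqrt_inv, ← Real.sqrt_mul (by positivity),
    ← Real.sqrt_inv]
  congr 1
  have := Real.pi_pos
  field_simp

lemma integral_exp_neg_mul_norm_sq_complexGaussian {s : ℝ} (hs : 0 ≤ s) :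
    ∫ z, Real.exp (-s * ‖z‖ ^ 2) ∂complexGaussian 1 = (1 + s)⁻¹ := by
  have e : ∀ z : ℂ, Real.exp (-s * ‖z‖ ^ 2) =
      Real.exp (-s * z.re ^ 2) * Real.exp (-s * z.im ^ 2) := fun z => by
    rw [← Real.exp_add, Complex.sq_norm, Complex.normSq_apply]; ring_nf
  simp_rw [e]
  rw [integral_re_mul_im_complexGaussian 1 (fun x => Real.exp (-s * x ^ 2))
    (fun x => Real.exp (-s * x ^ 2)) (by fun_prop) (by fun_prop),
    integral_exp_neg_mul_sq_gaussianReal hs, ← mul_inv, Real.mul_self_sqrt (by linarith)]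

/-- The Laplace representation of `1/x`. In `[0,∞]` it persists at `x = 0`, where both sides are
infinite, so no positivity has to be known in advance. -/
lemma lintegral_exp_neg_mul_Ioi {x : ℝ} (hx : 0 ≤ x) :
    ∫⁻ s in Set.Ioi (0 : ℝ), ENNReal.ofReal (Real.exp (-s * x)) = (ENNReal.ofReal x)⁻¹ := by
  rcases hx.eq_or_lt with rfl | hx
  · simp
  · have e : ∀ s : ℝ, -s * x = -x * s := fun s => by ring
    simp_rw [e]
    rw [← ofReal_integral_eq_lintegral_ofReal (integrableOn_exp_mul_Ioi (by linarith) 0)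
      (ae_of_all _ fun s => by positivity), integral_exp_mul_Ioi (by linarith),
      ← ENNReal.ofReal_inv_of_pos hx]
    congr 1
    simp [neg_div_neg_eq]

/-- The antiderivative `(1+t)^(1-n)/(1-n)` tends to zero at infinity because `n ≥ 2`. -/
lemma lintegral_inv_one_add_pow_Ioi {n : ℕ} (hn : 2 ≤ n) :
    ∫⁻ s in Set.Ioi (0 : ℝ), ENNReal.ofReal ((1 + s)⁻¹ ^ n) = ENNReal.ofReal (1 / ((n : ℝ) - 1)) := by
  have hn' : (2 : ℝ) ≤ n := by exact_mod_cast hn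
  have e : Set.EqOn (fun s : ℝ => ENNReal.ofReal ((1 + s)⁻¹ ^ n))
      (fun s => ENNReal.ofReal ((s + 1) ^ (-(n : ℝ)))) (Set.Ioi 0) := fun s hs => by
    have hs : 0 < s := hs
    simp only
    rw [Real.rpow_neg (by linarith), Real.rpow_natCast, inv_pow, add_comm]
  rw [setLIntegral_congr_fun measurableSet_Ioi e]
  have h_int := integrableOn_add_rpow_Ioi_of_lt (a := -(n : ℝ)) (c := 0) (m := 1) (by linarith)
    (by norm_num)
  have hd : ∀ x ∈ Set.Ici (0 : ℝ), HasDerivAt (fun t : ℝ => (t + 1) ^ (-(n : ℝ) + 1) / (-(n : ℝ) + 1))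
      ((x + 1) ^ (-(n : ℝ))) x := by
    intro x hx
    have hx : 0 ≤ x := hx
    convert! (((hasDerivAt_id x).add_const 1).rpow_const (p := -(n : ℝ) + 1) ?_).div_const
      (-(n : ℝ) + 1) using 1
    · simp [show -(n : ℝ) + 1 ≠ 0 by linarith]
    · left; simp only [id]; linarith
  have ht : Filter.Tendsto (fun t : ℝ => (t + 1) ^ (-(n : ℝ) + 1) / (-(n : ℝ) + 1)) Filter.atTop
      (nhds (0 / (-(n : ℝ) + 1))) := by
    have : -(n : ℝ) + 1 = -((n : ℝ) - 1) := by ring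
    rw [this]
    exact ((tendsto_rpow_neg_atTop (by linarith)).comp
      (Filter.tendsto_atTop_add_const_right _ 1 Filter.tendsto_id)).div_const _
  have hval := integral_Ioi_of_hasDerivAt_of_tendsto' hd h_int ht
  rw [← ofReal_integral_eq_lintegral_ofReal h_int, hval]
  · congr 1
    have h1 : -(n : ℝ) + 1 ≠ 0 := by linarith
    have h2 : (n : ℝ) - 1 ≠ 0 := by linarith
    simp
    field_simp
    ring
  · filter_upwards [ae_restrict_mem measurableSet_Ioi] with s hs
    have hs : 0 < s := hs
    positivity

variable {m : Type*} [Fintype m] [DecidableEq m]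

/-- The value of a Hermitian form in the coordinates of an eigenbasis. -/
lemma _root_.Matrix.IsHermitian.star_dotProduct_mulVec {Q : Matrix m m ℂ} (hQ : Q.IsHermitian)
    (x : m → ℂ) :
    star x ⬝ᵥ Q *ᵥ x =
      ∑ i, (hQ.eigenvalues i : ℂ) *
        ‖∑ j, star (hQ.eigenvectorUnitary : Matrix m m ℂ) i j * x j‖ ^ 2 := by
  set U : Matrix m m ℂ := (hQ.eigenvectorUnitary : Matrix m m ℂ)
  have h : Q = U * diagonal (RCLike.ofReal ∘ hQ.eigenvalues) * star U := hQ.spectral_theorem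
  have h2 : star x ⬝ᵥ Q *ᵥ x =
      star (star U *ᵥ x) ⬝ᵥ diagonal (RCLike.ofReal ∘ hQ.eigenvalues) *ᵥ (star U *ᵥ x) := by
    conv_lhs => rw [h]
    rw [← mulVec_mulVec, ← mulVec_mulVec, dotProduct_mulVec, star_mulVec, star_eq_conjTranspose,
      conjTranspose_conjTranspose]
  rw [h2, dotProduct]
  refine Finset.sum_congr rfl fun i _ => ?_
  rw [mulVec_diagonal, Pi.star_apply]
  change star (∑ j, star U i j * x j) * (_ * (∑ j, star U i j * x j)) = _
  rw [← Complex.conj_mul']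
  simp only [Function.comp, starRingEnd_apply, Complex.coe_algebraMap, RCLike.ofReal]
  ring

lemma eigenvalues_eq_zero_or_one {Q : Matrix m m ℂ} (hQ : Q.IsHermitian) (hQ2 : Q * Q = Q) (i : m) :
    hQ.eigenvalues i = 0 ∨ hQ.eigenvalues i = 1 := by
  have h := hQ.mulVec_eigenvectorBasis i
  have h2 : hQ.eigenvalues i • hQ.eigenvalues i • (hQ.eigenvectorBasis i).ofLp =
      hQ.eigenvalues i • (hQ.eigenvectorBasis i).ofLp := by
    rw [← h, ← mulVec_smul, ← h, mulVec_mulVec, hQ2]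
  rw [smul_smul] at h2
  have hne : (hQ.eigenvectorBasis i).ofLp ≠ 0 := fun h0 => by
    have : hQ.eigenvectorBasis i = 0 := by ext j; exact congrFun h0 j
    exact hQ.eigenvectorBasis.toBasis.ne_zero i (by simpa using this)
  have h3 := smul_left_injective ℝ hne h2
  rcases eq_or_ne (hQ.eigenvalues i) 0 with h | h
  · exact Or.inl h
  · exact Or.inr (mul_left_cancel₀ h (by simpa using h3))

/-- The eigenvalues are 0 or 1, so their sum, the trace, counts the ones. The trace thereby serves
as the rank of the projection. -/
lemma card_eigenvalues_eq_one {Q : Matrix m m ℂ} (hQ : Q.IsHermitian) (hQ2 : Q * Q = Q) {n : ℕ}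
    (hn : Q.trace = n) : (Finset.univ.filter fun i => hQ.eigenvalues i = 1).card = n := by
  have h := hQ.trace_eq_sum_eigenvalues
  rw [hn] at h
  have h1 : ∀ i, (hQ.eigenvalues i : ℂ) = if hQ.eigenvalues i = 1 then 1 else 0 := fun i => by
    rcases eigenvalues_eq_zero_or_one hQ hQ2 i with h | h <;> simp [h]
  have h2 : (n : ℂ) = ∑ i, (hQ.eigenvalues i : ℂ) := h
  simp_rw [h1] at h2
  rw [Finset.sum_boole] at h2
  exact_mod_cast h2.symm

/-- The standard circularly symmetric Gaussian law on `m → ℂ`. -/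
def stdComplexGaussian (m : Type*) [Fintype m] : Measure (m → ℂ) :=
  Measure.pi fun _ => complexGaussian 1

instance : IsProbabilityMeasure (stdComplexGaussian m) := by
  unfold stdComplexGaussian; infer_instance

/-- Unitary invariance: in an eigenbasis of `Q` the coordinates are again i.i.d. `CN(0,1)`, and the
form is the sum of `n` of their squared moduli. Each of these contributes a factor `(1+s)⁻¹`. -/
lemma integral_exp_neg_mul_quadForm {Q : Matrix m m ℂ} (hQ : Q.IsHermitian) (hQ2 : Q * Q = Q)
    {n : ℕ} (hn : Q.trace = n) {s : ℝ} (hs : 0 ≤ s) :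
    ∫ x, Real.exp (-s * (star x ⬝ᵥ Q *ᵥ x).re) ∂stdComplexGaussian m = (1 + s)⁻¹ ^ n := by
  set U : Matrix m m ℂ := (hQ.eigenvectorUnitary : Matrix m m ℂ) with hU
  have hUU : star U * U = 1 := by rw [hU]; simp
  have hX : ∀ j : m, HasLaw (fun x : m → ℂ => x j) (complexGaussian 1) (stdComplexGaussian m) :=
    fun j => (measurePreserving_eval (fun _ : m => complexGaussian 1) j).hasLaw
  have hI : iIndepFun (fun (j : m) (x : m → ℂ) => x j) (stdComplexGaussian m) :=
    iIndepFun_pi (X := fun _ z => z) fun _ => aemeasurable_id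
  have hcov : ∀ i k, ∑ j, star U i j * conj (star U k j) * ((1 : ℝ) : ℂ) =
      (1 : Matrix m m ℂ) i k := fun i k => by
    rw [← hUU, mul_apply]
    simp [star_apply]
  have hI' : iIndepFun (fun i (x : m → ℂ) => ∑ j, star U i j * x j) (stdComplexGaussian m) :=
    iIndepFun_linearForms hX (fun _ => zero_le_one) hI (star U) fun i k hik => by
      rw [hcov, one_apply_ne hik]
  have hL : ∀ i, HasLaw (fun x : m → ℂ => ∑ j, star U i j * x j) (complexGaussian 1)
      (stdComplexGaussian m) := fun i =>
    hasLaw_linearForm hX (fun _ => zero_le_one) hI (star U i) (by rw [hcov, one_apply_eq]; simp)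
  have e : ∀ x : m → ℂ, Real.exp (-s * (star x ⬝ᵥ Q *ᵥ x).re) =
      ∏ i, Real.exp (-(s * hQ.eigenvalues i) * ‖∑ j, star U i j * x j‖ ^ 2) := fun x => by
    rw [hQ.star_dotProduct_mulVec, ← Real.exp_sum, Complex.re_sum, Finset.mul_sum]
    congr 1
    refine Finset.sum_congr rfl fun i _ => ?_
    rw [← Complex.ofReal_pow, ← Complex.ofReal_mul, Complex.ofReal_re]
    ring
  simp_rw [e]
  rw [hI'.integral_fun_prod_comp (f := fun i z => Real.exp (-(s * hQ.eigenvalues i) * ‖z‖ ^ 2))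
    (fun i => (hL i).aemeasurable) fun i => Continuous.aestronglyMeasurable (by fun_prop)]
  have h0 : ∀ i, 0 ≤ hQ.eigenvalues i := fun i => by
    rcases eigenvalues_eq_zero_or_one hQ hQ2 i with h | h <;> simp [h]
  have e2 : ∀ i, ∫ x : m → ℂ, Real.exp (-(s * hQ.eigenvalues i) * ‖∑ j, star U i j * x j‖ ^ 2)
      ∂stdComplexGaussian m = if hQ.eigenvalues i = 1 then (1 + s)⁻¹ else 1 := fun i => by
    have := (hL i).integral_comp (f := fun z => Real.exp (-(s * hQ.eigenvalues i) * ‖z‖ ^ 2))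
      (Continuous.aestronglyMeasurable (by fun_prop))
    rw [Function.comp_def] at this
    rw [this, integral_exp_neg_mul_norm_sq_complexGaussian (mul_nonneg hs (h0 i))]
    rcases eigenvalues_eq_zero_or_one hQ hQ2 i with h | h <;> simp [h]
  simp_rw [e2]
  rw [Finset.prod_ite, Finset.prod_const, Finset.prod_const_one, mul_one,
    card_eigenvalues_eq_one hQ hQ2 hn]

lemma quadForm_re_nonneg {Q : Matrix m m ℂ} (hQ : Q.IsHermitian) (hQ2 : Q * Q = Q) (x : m → ℂ) :
    0 ≤ (star x ⬝ᵥ Q *ᵥ x).re := by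
  rw [hQ.star_dotProduct_mulVec, Complex.re_sum]
  refine Finset.sum_nonneg fun i _ => ?_
  rw [← Complex.ofReal_pow, ← Complex.ofReal_mul, Complex.ofReal_re]
  rcases eigenvalues_eq_zero_or_one hQ hQ2 i with h | h <;> simp [h]

/-- The inverse of the squared norm of the projection of a standard complex Gaussian vector to a
subspace of dimension `n` has mean `1 / (n - 1)`. -/
lemma lintegral_inv_quadForm {Q : Matrix m m ℂ} (hQ : Q.IsHermitian) (hQ2 : Q * Q = Q)
    {n : ℕ} (hn : Q.trace = n) (hn2 : 2 ≤ n) :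
    ∫⁻ x, (ENNReal.ofReal (star x ⬝ᵥ Q *ᵥ x).re)⁻¹ ∂stdComplexGaussian m =
      ENNReal.ofReal (1 / ((n : ℝ) - 1)) := by
  have hc : Continuous fun x : m → ℂ => (star x ⬝ᵥ Q *ᵥ x).re := by
    unfold dotProduct mulVec dotProduct
    fun_prop
  -- Replace the inverse by its Laplace integral and exchange the integrals by Tonelli; the inner
  -- one is then a known Laplace transform.
  simp_rw [← lintegral_exp_neg_mul_Ioi (quadForm_re_nonneg hQ hQ2 _)]
  rw [lintegral_lintegral_swap]
  · rw [← lintegral_inv_one_add_pow_Ioi hn2]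
    refine setLIntegral_congr_fun measurableSet_Ioi fun s hs => ?_
    have hs : 0 < s := hs
    rw [← integral_exp_neg_mul_quadForm hQ hQ2 hn hs.le, ofReal_integral_eq_lintegral_ofReal]
    · refine Integrable.of_bound (C := 1) (by fun_prop) (ae_of_all _ fun x => ?_)
      rw [Real.norm_eq_abs, Real.abs_exp, Real.exp_le_one_iff, neg_mul, neg_nonpos]
      exact mul_nonneg hs.le (quadForm_re_nonneg hQ hQ2 x)
    · exact ae_of_all _ fun x => by positivity
  · refine Measurable.aemeasurable ?_
    have := hc.measurable
    change Measurable fun p : (m → ℂ) × ℝ =>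
      ENNReal.ofReal (Real.exp (-p.2 * (star p.1 ⬝ᵥ Q *ᵥ p.1).re))
    exact ENNReal.measurable_ofReal.comp (Real.measurable_exp.comp
      (measurable_snd.neg.mul (this.comp measurable_fst)))

end InverseMoment

/-! ### Gram matrices, appended columns and Schur complements. -/

section Gram

lemma measurable_det {α n : Type*} [MeasurableSpace α] [Fintype n] [DecidableEq n]
    {A : α → Matrix n n ℂ} (hA : ∀ i j, Measurable fun x => A x i j) :
    Measurable fun x => (A x).det := by
  simp_rw [det_apply']
  fun_prop

/-- Cramer's rule. The inverse of the determinant is the total inverse on `ℂ`, so singular matrices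
need no separate treatment. -/
lemma measurable_inv_apply {α n : Type*} [MeasurableSpace α] [Fintype n] [DecidableEq n]
    {A : α → Matrix n n ℂ} (hA : ∀ i j, Measurable fun x => A x i j) (i j : n) :
    Measurable fun x => (A x)⁻¹ i j := by
  simp_rw [inv_def, Matrix.smul_apply, adjugate_apply, Ring.inverse_eq_inv', smul_eq_mul]
  refine (measurable_det hA).inv.mul (measurable_det fun k l => ?_)
  by_cases h : k = j
  · subst h; simp
  · simpa [updateRow_ne h] using hA k l

lemma measurable_mul_apply {α l m n : Type*} [MeasurableSpace α] [Fintype m]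
    {A : α → Matrix l m ℂ} {B : α → Matrix m n ℂ} (hA : ∀ i j, Measurable fun x => A x i j)
    (hB : ∀ i j, Measurable fun x => B x i j) (i : l) (j : n) :
    Measurable fun x => (A x * B x) i j := by
  simp_rw [mul_apply]
  fun_prop

variable {m ι : Type*} [Fintype m]

/-- The matrix with given columns. -/
def ofCols (o : ι → m → ℂ) : Matrix m ι ℂ := Matrix.of fun i j => o j i

lemma measurable_gram_ofCols_apply (i j : ι) :
    Measurable fun o : ι → m → ℂ => ((ofCols o)ᴴ * ofCols o) i j := by
  refine measurable_mul_apply (fun i j => ?_) (fun i j => ?_) i j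
  · simp only [conjTranspose_apply, ofCols, of_apply]; fun_prop
  · simp only [ofCols, of_apply]; fun_prop

/-- The matrix with a column `h` appended to `O`. -/
def appendCol (O : Matrix m ι ℂ) (h : m → ℂ) : Matrix m (ι ⊕ Unit) ℂ :=
  fromCols O (replicateCol Unit h)

lemma gram_appendCol (O : Matrix m ι ℂ) (h : m → ℂ) :
    (appendCol O h)ᴴ * appendCol O h =
      fromBlocks (Oᴴ * O) (Oᴴ * replicateCol Unit h) ((replicateCol Unit h)ᴴ * O)
        ((replicateCol Unit h)ᴴ * replicateCol Unit h) := by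
  rw [appendCol, conjTranspose_fromCols_eq_fromRows_conjTranspose, fromRows_mul_fromCols]

variable [DecidableEq m] [Fintype ι] [DecidableEq ι]

/-- The orthogonal projection to the complement of the columns of `O`, if these are linearly
independent. -/
def complProj (O : Matrix m ι ℂ) : Matrix m m ℂ := 1 - O * (Oᴴ * O)⁻¹ * Oᴴ

lemma complProj_isHermitian (O : Matrix m ι ℂ) : (complProj O).IsHermitian := by
  simp [complProj, IsHermitian, conjTranspose_sub, conjTranspose_mul, conjTranspose_nonsing_inv,
    Matrix.mul_assoc]

lemma complProj_mul_self {O : Matrix m ι ℂ} (hO : IsUnit (Oᴴ * O)) :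
    complProj O * complProj O = complProj O := by
  have hd : IsUnit (Oᴴ * O).det := (isUnit_iff_isUnit_det _).1 hO
  have h : O * (Oᴴ * O)⁻¹ * Oᴴ * (O * (Oᴴ * O)⁻¹ * Oᴴ) = O * (Oᴴ * O)⁻¹ * Oᴴ := by
    calc _ = O * ((Oᴴ * O)⁻¹ * (Oᴴ * O)) * (Oᴴ * O)⁻¹ * Oᴴ := by simp only [Matrix.mul_assoc]
      _ = _ := by rw [nonsing_inv_mul _ hd, Matrix.mul_one]
  simp only [complProj, Matrix.sub_mul, Matrix.mul_sub, Matrix.one_mul, Matrix.mul_one, h]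
  simp

/-- By cyclicity the subtracted term has the trace of `(OᴴO)⁻¹(OᴴO)`, the identity on `ι`. -/
lemma trace_complProj {O : Matrix m ι ℂ} (hO : IsUnit (Oᴴ * O)) {n : ℕ}
    (hn : Fintype.card ι + n = Fintype.card m) : (complProj O).trace = n := by
  have hd : IsUnit (Oᴴ * O).det := (isUnit_iff_isUnit_det _).1 hO
  rw [complProj, trace_sub, trace_one, Matrix.mul_assoc, trace_mul_comm, Matrix.mul_assoc,
    nonsing_inv_mul _ hd, trace_one, ← hn]
  push_cast; ring

/-- Factoring `h` out on both sides exposes the projection. When `OᴴO` is invertible, the Schur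
complement is thus the squared distance of `h` from the span of the columns of `O`. -/
lemma schur_appendCol (O : Matrix m ι ℂ) (h : m → ℂ) :
    (replicateCol Unit h)ᴴ * replicateCol Unit h -
      (replicateCol Unit h)ᴴ * O * (Oᴴ * O)⁻¹ * (Oᴴ * replicateCol Unit h) =
      Matrix.of fun _ _ => star h ⬝ᵥ complProj O *ᵥ h := by
  have e : (replicateCol Unit h)ᴴ * replicateCol Unit h -
      (replicateCol Unit h)ᴴ * O * (Oᴴ * O)⁻¹ * (Oᴴ * replicateCol Unit h) =
      (replicateCol Unit h)ᴴ * (complProj O * replicateCol Unit h) := by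
    simp only [complProj, Matrix.sub_mul, Matrix.mul_sub, Matrix.one_mul, Matrix.mul_assoc]
  rw [e]
  ext i j
  simp [mul_apply, dotProduct, mulVec]

lemma isUnit_gram_appendCol_iff {O : Matrix m ι ℂ} (hO : IsUnit (Oᴴ * O)) (h : m → ℂ) :
    IsUnit ((appendCol O h)ᴴ * appendCol O h) ↔ star h ⬝ᵥ complProj O *ᵥ h ≠ 0 := by
  cases hO.nonempty_invertible
  rw [gram_appendCol, isUnit_fromBlocks_iff_of_invertible₁₁, invOf_eq_nonsing_inv, schur_appendCol,
    isUnit_iff_isUnit_det, det_unique]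
  simp

/-- The lower right block of an inverse block matrix is the inverse of the Schur complement, which
here is a scalar. -/
lemma gram_appendCol_inv_apply {O : Matrix m ι ℂ} (hO : IsUnit (Oᴴ * O)) {h : m → ℂ}
    (hh : star h ⬝ᵥ complProj O *ᵥ h ≠ 0) :
    ((appendCol O h)ᴴ * appendCol O h)⁻¹ (.inr ()) (.inr ()) =
      (star h ⬝ᵥ complProj O *ᵥ h)⁻¹ := by
  have hU := (isUnit_gram_appendCol_iff hO h).2 hh
  cases hO.nonempty_invertible
  rw [gram_appendCol] at hU ⊢
  cases hU.nonempty_invertible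
  let := invertibleOfFromBlocks₁₁Invertible (Oᴴ * O) (Oᴴ * replicateCol Unit h)
    ((replicateCol Unit h)ᴴ * O) ((replicateCol Unit h)ᴴ * replicateCol Unit h)
  rw [← invOf_eq_nonsing_inv, invOf_fromBlocks₁₁_eq]
  simp only [fromBlocks_apply₂₂]
  rw [invOf_eq_nonsing_inv, invOf_eq_nonsing_inv, schur_appendCol, inv_def, det_unique,
    adjugate_subsingleton]
  simp

lemma star_dotProduct_complProj_eq_ofReal (O : Matrix m ι ℂ) (h : m → ℂ) :
    star h ⬝ᵥ complProj O *ᵥ h = ((star h ⬝ᵥ complProj O *ᵥ h).re : ℂ) := by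
  rw [(complProj_isHermitian O).star_dotProduct_mulVec]
  simp_rw [← Complex.ofReal_pow, ← Complex.ofReal_mul, ← Complex.ofReal_sum, Complex.ofReal_re]

variable {Ω : Type*} [MeasurableSpace Ω] {P : Measure Ω} [IsProbabilityMeasure P]

lemma measurable_quadForm_complProj :
    Measurable fun p : (ι → m → ℂ) × (m → ℂ) =>
      (star p.2 ⬝ᵥ complProj (ofCols p.1) *ᵥ p.2).re := by
  have h : ∀ i j, Measurable fun o : ι → m → ℂ => complProj (ofCols o) i j := fun i j => by
    simp only [complProj, Matrix.sub_apply]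
    refine measurable_const.sub (measurable_mul_apply (fun i j => ?_) (fun i j => ?_) i j)
    · refine measurable_mul_apply (fun i j => ?_)
        (measurable_inv_apply measurable_gram_ofCols_apply) i j
      simp only [ofCols, of_apply]; fun_prop
    · simp only [conjTranspose_apply, ofCols, of_apply]; fun_prop
  simp only [dotProduct, mulVec, Pi.star_apply]
  refine Complex.measurable_re.comp (Finset.measurable_fun_sum _ fun i _ => ?_)
  refine Measurable.mul (by fun_prop) (Finset.measurable_fun_sum _ fun j _ => ?_)
  exact ((h i j).comp measurable_fst).mul (by fun_prop)

/-- The mean of the inverse squared distance of a standard complex Gaussian vector to the span of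
an independent, almost surely linearly independent family. -/
lemma lintegral_inv_quadForm_complProj {O : Ω → ι → m → ℂ} {h : Ω → m → ℂ}
    (hOm : AEMeasurable O P) (hh : HasLaw h (stdComplexGaussian m) P) (hOh : IndepFun O h P)
    (hO : ∀ᵐ ω ∂P, IsUnit ((ofCols (O ω))ᴴ * ofCols (O ω)))
    {n : ℕ} (hn : Fintype.card ι + n = Fintype.card m) (hn2 : 2 ≤ n) :
    ∫⁻ ω, (ENNReal.ofReal (star (h ω) ⬝ᵥ complProj (ofCols (O ω)) *ᵥ h ω).re)⁻¹ ∂P =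
      ENNReal.ofReal (1 / ((n : ℝ) - 1)) := by
  have hF : Measurable fun p : (ι → m → ℂ) × (m → ℂ) =>
      (ENNReal.ofReal (star p.2 ⬝ᵥ complProj (ofCols p.1) *ᵥ p.2).re)⁻¹ :=
    measurable_quadForm_complProj.ennreal_ofReal.inv
  have hprob : IsProbabilityMeasure (P.map O) := Measure.isProbabilityMeasure_map hOm
  have hmap : P.map (fun ω => (O ω, h ω)) = (P.map O).prod (stdComplexGaussian m) := by
    rw [← hh.map_eq]
    exact (indepFun_iff_map_prod_eq_prod_map_map hOm hh.aemeasurable).1 hOh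
  have h1 : ∫⁻ ω, (ENNReal.ofReal (star (h ω) ⬝ᵥ complProj (ofCols (O ω)) *ᵥ h ω).re)⁻¹ ∂P =
      ∫⁻ p, (ENNReal.ofReal (star p.2 ⬝ᵥ complProj (ofCols p.1) *ᵥ p.2).re)⁻¹
        ∂(P.map (fun ω => (O ω, h ω))) := by
    rw [lintegral_map' hF.aemeasurable (hOm.prodMk hh.aemeasurable)]
  -- Independence lets `O` be frozen at a value `o`. For almost every `o` the projection is fixed
  -- and of rank `n`, so the inner integral does not depend on `o`.
  rw [h1, hmap, lintegral_prod _ hF.aemeasurable]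
  have hset : MeasurableSet {o : ι → m → ℂ | IsUnit ((ofCols o)ᴴ * ofCols o)} := by
    simp_rw [isUnit_iff_isUnit_det, isUnit_iff_ne_zero]
    exact (measurable_det measurable_gram_ofCols_apply) (measurableSet_singleton 0).compl
  have hO' : ∀ᵐ o ∂(P.map O), IsUnit ((ofCols o)ᴴ * ofCols o) := (ae_map_iff hOm hset).2 hO
  have h2 : ∀ᵐ o ∂(P.map O), ∫⁻ x, (ENNReal.ofReal (star x ⬝ᵥ complProj (ofCols o) *ᵥ x).re)⁻¹
      ∂stdComplexGaussian m = ENNReal.ofReal (1 / ((n : ℝ) - 1)) := by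
    filter_upwards [hO'] with o ho
    exact lintegral_inv_quadForm (complProj_isHermitian _) (complProj_mul_self ho)
      (trace_complProj ho hn) hn2
  rw [lintegral_congr_ae h2, lintegral_const, measure_univ, mul_one]

/-- In `[0,∞]` the inverse of zero is infinite, so a finite inverse moment excludes zeros almost
surely. The price is a complement of dimension at least two. -/
lemma ae_quadForm_complProj_ne_zero {O : Ω → ι → m → ℂ} {h : Ω → m → ℂ}
    (hOm : AEMeasurable O P) (hh : HasLaw h (stdComplexGaussian m) P) (hOh : IndepFun O h P)
    (hO : ∀ᵐ ω ∂P, IsUnit ((ofCols (O ω))ᴴ * ofCols (O ω)))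
    (hn : Fintype.card ι + 2 ≤ Fintype.card m) :
    ∀ᵐ ω ∂P, star (h ω) ⬝ᵥ complProj (ofCols (O ω)) *ᵥ h ω ≠ 0 := by
  obtain ⟨n, hn'⟩ := Nat.exists_eq_add_of_le hn
  have hl := lintegral_inv_quadForm_complProj hOm hh hOh hO (n := n + 2) (by omega) (by omega)
  have hm := (measurable_quadForm_complProj (m := m) (ι := ι)).comp_aemeasurable
    (hOm.prodMk hh.aemeasurable)
  have hF := hm.ennreal_ofReal.inv
  have hlt := ae_lt_top' hF (ne_of_eq_of_ne hl ENNReal.ofReal_ne_top)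
  filter_upwards [hlt] with ω hω h0
  simp [h0] at hω

end Gram

/-! ### The inverse Gram matrix of a standard complex Gaussian matrix. -/

section IIDMatrix

variable {m κ : Type*} [Fintype m] {Ω : Type*} [MeasurableSpace Ω] {P : Measure Ω}
  {B : Ω → Matrix m κ ℂ}

lemma hasLaw_column (hB : ∀ i k, HasLaw (fun ω => B ω i k) (complexGaussian 1) P)
    (hI : iIndepFun (fun (q : m × κ) ω => B ω q.1 q.2) P) (a : κ) :
    HasLaw (fun ω i => B ω i a) (stdComplexGaussian m) P :=
  iIndepFun.hasLaw_pi (fun i => hB i a)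
    (hI.precomp (g := fun i : m => (i, a)) fun _ _ h => (Prod.mk.inj h).1)

lemma aemeasurable_columns (hB : ∀ i k, HasLaw (fun ω => B ω i k) (complexGaussian 1) P)
    {ι : Type*} [Countable ι] (f : ι → κ) : AEMeasurable (fun ω i j => B ω j (f i)) P :=
  aemeasurable_pi_lambda _ fun i => aemeasurable_pi_lambda _ fun j => (hB j (f i)).aemeasurable

lemma gram_submatrix {ι : Type*} (A : Matrix m κ ℂ) (e : ι → κ) :
    (A.submatrix id e)ᴴ * A.submatrix id e = (Aᴴ * A).submatrix e e := by
  ext i j; simp [mul_apply]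

variable [Fintype κ] [DecidableEq κ]

/-- The two families use disjoint sets of entries. The map `f` may be any selection that avoids `a`.
-/
lemma indepFun_columns (hB : ∀ i k, HasLaw (fun ω => B ω i k) (complexGaussian 1) P)
    (hI : iIndepFun (fun (q : m × κ) ω => B ω q.1 q.2) P) {ι : Type*} (f : ι → κ) {a : κ}
    (ha : ∀ i, f i ≠ a) :
    IndepFun (fun ω i j => B ω j (f i)) (fun ω j => B ω j a) P := by
  set s : Finset (m × κ) := Finset.univ.filter fun q => q.2 ≠ a with hs
  set t : Finset (m × κ) := Finset.univ.filter fun q => q.2 = a with ht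
  have h := hI.indepFun_finset₀ s t
    (by rw [Finset.disjoint_left]; intro q; simp [hs, ht]) fun q => (hB q.1 q.2).aemeasurable
  let φ : (s → ℂ) → ι → m → ℂ := fun x i j => x ⟨(j, f i), by simp [hs, ha i]⟩
  let ψ : (t → ℂ) → m → ℂ := fun x j => x ⟨(j, a), by simp [ht]⟩
  have hφ : Measurable φ :=
    measurable_pi_lambda _ fun i => measurable_pi_lambda _ fun j => measurable_pi_apply _
  have hψ : Measurable ψ := measurable_pi_lambda _ fun j => measurable_pi_apply _
  exact h.comp hφ hψ

variable [DecidableEq m]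

variable [IsProbabilityMeasure P]

/-- Induction on the number of columns: a new column is independent of the earlier ones and almost
surely outside their span. The bound on `n` is strict because the previous columns must leave a
complement of dimension at least two for the inverse moment to be finite. -/
lemma ae_isUnit_gram_submatrix (hB : ∀ i k, HasLaw (fun ω => B ω i k) (complexGaussian 1) P)
    (hI : iIndepFun (fun (q : m × κ) ω => B ω q.1 q.2) P) (n : ℕ) (hn : n < Fintype.card m)
    (f : Fin n → κ) (hf : Function.Injective f) :
    ∀ᵐ ω ∂P, IsUnit (((B ω)ᴴ * B ω).submatrix f f) := by
  induction n with
  | zero => exact ae_of_all _ fun ω => by rw [isUnit_iff_isUnit_det, det_isEmpty]; exact isUnit_one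
  | succ n ih =>
    set g : Fin n → κ := f ∘ Fin.castSucc with hg
    have hO := ih (by omega) g (hf.comp (Fin.castSucc_injective n))
    have hO' : ∀ᵐ ω ∂P, IsUnit
        ((ofCols fun i j => B ω j (g i))ᴴ * ofCols fun i j => B ω j (g i)) := by
      filter_upwards [hO] with ω h
      rwa [← gram_submatrix] at h
    have hne := ae_quadForm_complProj_ne_zero (aemeasurable_columns hB g)
      (hasLaw_column hB hI (f (Fin.last n)))
      (indepFun_columns hB hI g fun i h => (Fin.castSucc_lt_last i).ne (hf h)) hO'
      (by simp; omega)
    filter_upwards [hO', hne] with ω h1 h2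
    have h3 := (isUnit_gram_appendCol_iff h1 _).2 h2
    -- The extra point goes to `Fin.last n`, the index of the appended column.
    let e : Fin n ⊕ Unit ≃ Fin (n + 1) :=
      (finSuccEquivLast.trans (Equiv.optionEquivSumPUnit (Fin n))).symm
    have h4 : appendCol (ofCols fun i j => B ω j (g i)) (fun j => B ω j (f (Fin.last n))) =
        (B ω).submatrix id (f ∘ e) := by
      ext i (j | j)
      · simp [appendCol, ofCols, e, hg]
      · simp [appendCol, e]
    rw [h4, gram_submatrix, ← submatrix_submatrix] at h3
    exact (isUnit_submatrix_equiv e e).1 h3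

lemma ae_isUnit_gram (hB : ∀ i k, HasLaw (fun ω => B ω i k) (complexGaussian 1) P)
    (hI : iIndepFun (fun (q : m × κ) ω => B ω q.1 q.2) P)
    (hn : Fintype.card κ < Fintype.card m) : ∀ᵐ ω ∂P, IsUnit ((B ω)ᴴ * B ω) := by
  filter_upwards [ae_isUnit_gram_submatrix hB hI _ hn (Fintype.equivFin κ).symm
    (Equiv.injective _)] with ω h
  exact (isUnit_submatrix_equiv _ _).1 h

/-- The diagonal entries of the inverse Gram matrix of a standard complex Gaussian matrix. -/
lemma lintegral_gram_inv_apply (hB : ∀ i k, HasLaw (fun ω => B ω i k) (complexGaussian 1) P)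
    (hI : iIndepFun (fun (q : m × κ) ω => B ω q.1 q.2) P)
    (hn : Fintype.card κ < Fintype.card m) (k : κ) :
    ∫⁻ ω, ENNReal.ofReal ((((B ω)ᴴ * B ω)⁻¹ k k).re) ∂P =
      ENNReal.ofReal (1 / ((Fintype.card m : ℝ) - Fintype.card κ)) := by
  let ι := {j : κ // j ≠ k}
  let g : ι → κ := Subtype.val
  have hcard : Fintype.card ι + 1 = Fintype.card κ := by
    have := Fintype.card_subtype_compl (fun j : κ => j = k)
    have h1 : 0 < Fintype.card κ := Fintype.card_pos_iff.2 ⟨k⟩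
    simp only [Fintype.card_unique] at this
    change Fintype.card {j : κ // ¬ j = k} + 1 = _
    omega
  have hg : Function.Injective g := Subtype.val_injective
  have hO : ∀ᵐ ω ∂P, IsUnit
      ((ofCols fun i j => B ω j (g i))ᴴ * ofCols fun i j => B ω j (g i)) := by
    filter_upwards [ae_isUnit_gram_submatrix hB hI (Fintype.card ι) (by omega)
      (g ∘ (Fintype.equivFin ι).symm) (hg.comp (Equiv.injective _))] with ω h
    rw [← submatrix_submatrix, isUnit_submatrix_equiv, ← gram_submatrix] at h
    exact h
  obtain ⟨n, hn'⟩ := Nat.exists_eq_add_of_lt hn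
  -- Here `card m = card κ + n + 1`, and one column is set aside, so the complement of the others
  -- has dimension `n + 2`. The mean is `1/(n+1)`, that is `1/(card m - card κ)`.
  have hl := lintegral_inv_quadForm_complProj (aemeasurable_columns hB g)
    (hasLaw_column hB hI k) (indepFun_columns hB hI g fun i => i.2) hO (n := n + 2) (by omega)
    (by omega)
  have hne := ae_quadForm_complProj_ne_zero (aemeasurable_columns hB g)
    (hasLaw_column hB hI k) (indepFun_columns hB hI g fun i => i.2) hO (by omega)
  have e1 : (((n + 2 : ℕ) : ℝ) - 1) = (Fintype.card m : ℝ) - Fintype.card κ := by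
    rw [hn']; push_cast; ring
  rw [← e1, ← hl]
  refine lintegral_congr_ae ?_
  filter_upwards [hO, hne] with ω h1 h2
  have h3 := gram_appendCol_inv_apply h1 h2
  -- Reorders the columns so that `k` comes last; the corner entry of the inverse then becomes the
  -- entry at `(k, k)`.
  let e : ι ⊕ Unit ≃ κ := (Equiv.sumComm _ _).trans
    ((Equiv.sumCongr (Equiv.ofUnique Unit {j : κ // j = k}) (Equiv.refl _)).trans
      (Equiv.sumCompl fun j => j = k))
  have h4 : appendCol (ofCols fun i j => B ω j (g i)) (fun j => B ω j k) =
      (B ω).submatrix id e := by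
    ext i (j | j)
    · rfl
    · rfl
  rw [h4, gram_submatrix, inv_submatrix_equiv, submatrix_apply] at h3
  have h5 : e (.inr ()) = k := rfl
  rw [h5] at h3
  have hr := star_dotProduct_complProj_eq_ofReal (ofCols fun i j => B ω j (g i))
    (fun j => B ω j k)
  rw [h3, hr, ← Complex.ofReal_inv, Complex.ofReal_re, ENNReal.ofReal_inv_of_pos,
    Complex.ofReal_re]
  refine lt_of_le_of_ne (quadForm_re_nonneg (complProj_isHermitian _) (complProj_mul_self h1) _) ?_
  intro h0
  rw [hr, ← h0] at h2
  simp at h2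

end IIDMatrix

/-! ### Orthogonality in `L²`, uniqueness of the MMSE estimate and moments of bilinear sums. -/

section Moments

variable {Ω : Type*} [MeasurableSpace Ω] {P : Measure Ω}

lemma integrable_norm_sq {A : Ω → ℂ} (hA : MemLp A 2 P) : Integrable (fun ω => ‖A ω‖ ^ 2) P :=
  (memLp_two_iff_integrable_sq_norm hA.aestronglyMeasurable).1 hA

lemma ofReal_integral_norm_sq (A : Ω → ℂ) :
    ((∫ ω, ‖A ω‖ ^ 2 ∂P : ℝ) : ℂ) = ∫ ω, A ω * conj (A ω) ∂P := by
  rw [← integral_complex_ofReal]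
  simp_rw [Complex.mul_conj', Complex.ofReal_pow]

lemma integral_norm_add_sq {A B : Ω → ℂ} (hA : MemLp A 2 P) (hB : MemLp B 2 P)
    (hAB : ∫ ω, A ω * conj (B ω) ∂P = 0) :
    ∫ ω, ‖A ω + B ω‖ ^ 2 ∂P = ∫ ω, ‖A ω‖ ^ 2 ∂P + ∫ ω, ‖B ω‖ ^ 2 ∂P := by
  have hi : Integrable (fun ω => A ω * conj (B ω)) P := hA.integrable_mul hB.star
  have hre : ∫ ω, (A ω * conj (B ω)).re ∂P = 0 := by
    have := integral_re hi
    simp only [RCLike.re_to_complex] at this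
    rw [this, hAB, Complex.zero_re]
  have e : ∀ ω, ‖A ω + B ω‖ ^ 2 = ‖A ω‖ ^ 2 + ‖B ω‖ ^ 2 + 2 * (A ω * conj (B ω)).re := fun ω => by
    simp only [Complex.sq_norm]
    exact Complex.normSq_add _ _
  simp_rw [e]
  have hi2 : Integrable (fun ω => 2 * (A ω * conj (B ω)).re) P := hi.re.const_mul 2
  have hi3 : Integrable (fun ω => ‖A ω‖ ^ 2 + ‖B ω‖ ^ 2) P :=
    (integrable_norm_sq hA).add (integrable_norm_sq hB)
  rw [integral_add hi3 hi2, integral_add (integrable_norm_sq hA) (integrable_norm_sq hB),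
    integral_const_mul, hre]
  ring

/-- If `X` is the sum of a function of the observation and of a centred variable independent of
the observation, then the first summand is the only minimum mean-square error estimate. -/
lemma IsMMSEEstimate.ae_eq {E : Type*} [MeasurableSpace E] {X Xhat err : Ω → ℂ} {Y : Ω → E}
    (h : IsMMSEEstimate P X Y Xhat) {ψ : E → ℂ} (hψ : Measurable ψ)
    (hψ2 : MemLp (fun ω => ψ (Y ω)) 2 P) (herr : MemLp err 2 P)
    (herr0 : ∫ ω, err ω ∂P = 0) (hI : IndepFun err Y P) (hX : ∀ ω, X ω = ψ (Y ω) + err ω) :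
    ∀ᵐ ω ∂P, Xhat ω = ψ (Y ω) := by
  obtain ⟨⟨φ, hφ, hXφ⟩, hXhat, hmin⟩ := h
  have hD : MemLp (fun ω => ψ (Y ω) - Xhat ω) 2 P := hψ2.sub hXhat
  have hcross : ∫ ω, err ω * conj (ψ (Y ω) - Xhat ω) ∂P = 0 := by
    have hI' : IndepFun err (fun ω => conj (ψ (Y ω) - Xhat ω)) P := by
      simp_rw [hXφ]
      exact hI.comp measurable_id
        (Complex.continuous_conj.measurable.comp (hψ.sub hφ) : Measurable fun y => conj (ψ y - φ y))
    rw [hI'.integral_fun_mul_eq_mul_integral herr.aestronglyMeasurable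
      hD.star.aestronglyMeasurable, herr0, zero_mul]
  have h1 := integral_norm_add_sq herr hD hcross
  have h2 := hmin ψ hψ hψ2
  have e1 : ∀ ω, X ω - Xhat ω = err ω + (ψ (Y ω) - Xhat ω) := fun ω => by rw [hX]; ring
  have e2 : ∀ ω, X ω - ψ (Y ω) = err ω := fun ω => by rw [hX]; ring
  simp_rw [e1, e2] at h2
  -- Pythagoras makes the error of `Xhat` equal to `E‖err‖²` plus this integral, while minimality
  -- bounds it by `E‖err‖²`, the error of the competitor `ψ`.
  have h3 : ∫ ω, ‖ψ (Y ω) - Xhat ω‖ ^ 2 ∂P = 0 :=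
    le_antisymm (by linarith) (integral_nonneg fun ω => by positivity)
  rw [integral_eq_zero_iff_of_nonneg (fun ω => by positivity) (integrable_norm_sq hD)] at h3
  filter_upwards [h3] with ω hω
  have : ψ (Y ω) - Xhat ω = 0 := by simpa using hω
  exact (sub_eq_zero.1 this).symm

/-- A product of two `L²` variables is in general only integrable; independence factors `E‖ab‖²` and
keeps it in `L²`. -/
lemma memLp_mul_of_indepFun {a b : Ω → ℂ} (ha : MemLp a 2 P) (hb : MemLp b 2 P)
    (hI : IndepFun a b P) : MemLp (fun ω => a ω * b ω) 2 P := by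
  have hm : AEStronglyMeasurable (fun ω => a ω * b ω) P :=
    ha.aestronglyMeasurable.mul hb.aestronglyMeasurable
  rw [memLp_two_iff_integrable_sq_norm hm]
  simp_rw [norm_mul, mul_pow]
  have hI' : IndepFun (fun ω => ‖a ω‖ ^ 2) (fun ω => ‖b ω‖ ^ 2) P :=
    hI.comp (φ := fun z => ‖z‖ ^ 2) (ψ := fun z => ‖z‖ ^ 2) (by fun_prop) (by fun_prop)
  exact hI'.integrable_mul (integrable_norm_sq ha) (integrable_norm_sq hb)

variable {m : Type*} {A B : m → Ω → ℂ}

lemma indepFun_apply (hI : IndepFun (fun ω i => A i ω) (fun ω i => B i ω) P) (i j : m) :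
    IndepFun (A i) (B j) P :=
  hI.comp (measurable_pi_apply i) (measurable_pi_apply j)

variable [Fintype m]

lemma memLp_sum_mul (hA : ∀ i, MemLp (A i) 2 P) (hB : ∀ i, MemLp (B i) 2 P)
    (hI : IndepFun (fun ω i => A i ω) (fun ω i => B i ω) P) :
    MemLp (fun ω => ∑ i, A i ω * B i ω) 2 P :=
  memLp_finsetSum _ fun i _ => memLp_mul_of_indepFun (hA i) (hB i) (indepFun_apply hI i i)

lemma integral_sum_mul [IsProbabilityMeasure P] (hA : ∀ i, MemLp (A i) 2 P)
    (hB : ∀ i, MemLp (B i) 2 P) (hA0 : ∀ i, ∫ ω, A i ω ∂P = 0)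
    (hI : IndepFun (fun ω i => A i ω) (fun ω i => B i ω) P) :
    ∫ ω, ∑ i, A i ω * B i ω ∂P = 0 := by
  rw [integral_finsetSum _ fun i _ =>
    (memLp_mul_of_indepFun (hA i) (hB i) (indepFun_apply hI i i)).integrable (by norm_num)]
  refine Finset.sum_eq_zero fun i _ => ?_
  rw [(indepFun_apply hI i i).integral_fun_mul_eq_mul_integral (hA i).aestronglyMeasurable
    (hB i).aestronglyMeasurable, hA0, zero_mul]

/-- The second moment of the bilinear pairing of an uncorrelated family with an independent one. -/
lemma integral_norm_sum_mul_sq [DecidableEq m] (hA : ∀ i, MemLp (A i) 2 P)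
    (hB : ∀ i, MemLp (B i) 2 P)
    {a : ℝ} (hAA : ∀ i j, ∫ ω, A i ω * conj (A j ω) ∂P = if i = j then (a : ℂ) else 0)
    (hI : IndepFun (fun ω i => A i ω) (fun ω i => B i ω) P) :
    ∫ ω, ‖∑ i, A i ω * B i ω‖ ^ 2 ∂P = a * ∑ i, ∫ ω, ‖B i ω‖ ^ 2 ∂P := by
  have hAi : ∀ i j, Integrable (fun ω => A i ω * conj (A j ω)) P := fun i j =>
    (hA i).integrable_mul (hA j).star
  have hBi : ∀ i j, Integrable (fun ω => B i ω * conj (B j ω)) P := fun i j =>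
    (hB i).integrable_mul (hB j).star
  have hI' : ∀ i j, IndepFun (fun ω => A i ω * conj (A j ω)) (fun ω => B i ω * conj (B j ω)) P :=
    fun i j => by
      have hm : Measurable fun x : m → ℂ => x i * conj (x j) :=
        (measurable_pi_apply i).mul
          (Complex.continuous_conj.measurable.comp (measurable_pi_apply j))
      exact hI.comp hm hm
  have h_int : ∀ i j, Integrable
      (fun ω => A i ω * conj (A j ω) * (B i ω * conj (B j ω))) P := fun i j =>
    (hI' i j).integrable_mul (hAi i j) (hBi i j)
  have e : ∀ ω, (∑ i, A i ω * B i ω) * conj (∑ i, A i ω * B i ω) =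
      ∑ i, ∑ j, A i ω * conj (A j ω) * (B i ω * conj (B j ω)) := fun ω => by
    rw [map_sum, Finset.sum_mul_sum]
    refine Finset.sum_congr rfl fun i _ => Finset.sum_congr rfl fun j _ => ?_
    rw [map_mul]; ring
  have h : ((∫ ω, ‖∑ i, A i ω * B i ω‖ ^ 2 ∂P : ℝ) : ℂ) =
      ((a * ∑ i, ∫ ω, ‖B i ω‖ ^ 2 ∂P : ℝ) : ℂ) := by
    rw [ofReal_integral_norm_sq]
    simp_rw [e]
    rw [integral_finsetSum _ fun i _ => integrable_finsetSum _ fun j _ => h_int i j]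
    push_cast
    rw [Finset.mul_sum]
    refine Finset.sum_congr rfl fun i _ => ?_
    rw [integral_finsetSum _ fun j _ => h_int i j]
    -- Cross terms are killed by the `A` factor alone. The `B i` may be correlated, as the entries
    -- of a precoder column can be.
    have h1 : ∀ j, ∫ ω, A i ω * conj (A j ω) * (B i ω * conj (B j ω)) ∂P =
        (if i = j then (a : ℂ) else 0) * ∫ ω, B i ω * conj (B j ω) ∂P := fun j => by
      rw [(hI' i j).integral_fun_mul_eq_mul_integral (hAi i j).aestronglyMeasurable
        (hBi i j).aestronglyMeasurable, hAA]
    simp_rw [h1, ite_mul, zero_mul]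
    rw [Finset.sum_ite_eq, if_pos (Finset.mem_univ i), ← ofReal_integral_norm_sq]
  exact_mod_cast h

end Moments

/-! ### The pilot signal as linear forms in independent Gaussian sources. -/

namespace Model

variable {Ω : Type*} [MeasurableSpace Ω] {P : Measure Ω} {M K N τp : ℕ} {p : Params K}

/-- The independent Gaussian variables of the training phase. -/
def source (S : Model P M K N τp p)
    (j : (Fin M × Fin K) ⊕ (Fin N × Fin M) ⊕ (Fin M × Fin τp)) (ω : Ω) : ℂ :=
  Sum.elim (fun a => S.Z ω a.1 a.2)
    (Sum.elim (fun a => conj (S.R ω a.1 a.2)) (fun a => S.W ω a.1 a.2)) j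

/-- The variances of the independent Gaussian variables of the training phase. -/
def sourceVar (_ : Model P M K N τp p) :
    (Fin M × Fin K) ⊕ (Fin N × Fin M) ⊕ (Fin M × Fin τp) → ℝ :=
  Sum.elim (fun _ => 1) (Sum.elim (fun _ => p.βbr) (fun _ => p.σC2))

lemma sourceVar_nonneg (S : Model P M K N τp p) (j) : 0 ≤ S.sourceVar j := by
  rcases j with a | a | a
  · exact zero_le_one
  · exact p.βbr_nonneg
  · exact p.σC2_pos.le

lemma hasLaw_source (S : Model P M K N τp p) (j) :
    HasLaw (S.source j) (complexGaussian (S.sourceVar j)) P := by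
  rcases j with a | a | a
  · exact S.hasLaw_Z a.1 a.2
  · exact hasLaw_conj (S.hasLaw_R a.1 a.2) p.βbr_nonneg
  · exact S.hasLaw_W a.1 a.2

lemma iIndepFun_source (S : Model P M K N τp p) : iIndepFun S.source P := by
  have h := S.indep_ZRW.comp (fun j => Sum.elim (fun _ => id)
    (Sum.elim (fun _ => conj) (fun _ => id)) j) (fun j => by
      rcases j with a | a | a
      · exact measurable_id
      · exact Complex.continuous_conj.measurable
      · exact measurable_id)
  convert! h using 1
  ext j ω
  rcases j with a | a | a <;> rfl

/-- The coefficients of the received pilot signal. -/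
def coeffY (S : Model P M K N τp p) :
    Matrix (Fin M × Fin τp) ((Fin M × Fin K) ⊕ (Fin N × Fin M) ⊕ (Fin M × Fin τp)) ℂ :=
  Matrix.of fun q => Sum.elim
    (fun a => if a.1 = q.1 then (√(τp * p.ρu) : ℂ) * √(p.β a.2) * conj (S.Φp q.2 a.2) else 0)
    (Sum.elim (fun a => if a.2 = q.1 then (√(τp * p.PR) : ℂ) * conj (S.Φr q.2 a.1) else 0)
      (fun a => if a = q then 1 else 0))

/-- The coefficients of the matrix with entries `x_k Z_{mk} + y_k (W Φ_p)_{mk}`. -/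
def coeffU (S : Model P M K N τp p) (x y : Fin K → ℝ) :
    Matrix (Fin M × Fin K) ((Fin M × Fin K) ⊕ (Fin N × Fin M) ⊕ (Fin M × Fin τp)) ℂ :=
  Matrix.of fun q => Sum.elim
    (fun a => if a = q then (x q.2 : ℂ) else 0)
    (Sum.elim (fun _ => 0)
      (fun a => if a.1 = q.1 then (y q.2 : ℂ) * S.Φp a.2 q.2 else 0))

lemma sum_coeffY (S : Model P M K N τp p) (q : Fin M × Fin τp) (ω : Ω) :
    ∑ j, S.coeffY q j * S.source j ω = S.Y ω q.1 q.2 := by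
  simp only [coeffY, source, Fintype.sum_sum_type, of_apply, Sum.elim_inl, Sum.elim_inr,
    Fintype.sum_prod_type, ite_mul, zero_mul, one_mul, Finset.sum_ite_irrel, Finset.sum_const_zero,
    Finset.sum_ite_eq', Finset.mem_univ, if_true, Y, G, Matrix.add_apply, Matrix.smul_apply,
    mul_apply, conjTranspose_apply, smul_eq_mul, Finset.mul_sum, Prod.ext_iff, ite_and,
    Complex.star_def]
  rw [add_comm (∑ x, _ * (conj (S.R ω x q.1) * _)), add_assoc]
  congr 1
  · exact Finset.sum_congr rfl fun k _ => by ring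
  · congr 1
    exact Finset.sum_congr rfl fun k _ => by ring

lemma sum_coeffU (S : Model P M K N τp p) (x y : Fin K → ℝ) (q : Fin M × Fin K) (ω : Ω) :
    ∑ j, S.coeffU x y q j * S.source j ω =
      x q.2 * S.Z ω q.1 q.2 + y q.2 * (S.W ω * S.Φp) q.1 q.2 := by
  simp only [coeffU, source, Fintype.sum_sum_type, of_apply, Sum.elim_inl, Sum.elim_inr,
    Fintype.sum_prod_type, ite_mul, zero_mul, Finset.sum_ite_irrel, Finset.sum_const_zero,
    Finset.sum_ite_eq', Finset.mem_univ, if_true,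
    mul_apply, Finset.mul_sum, Prod.ext_iff, ite_and, zero_add]
  congr 1
  exact Finset.sum_congr rfl fun k _ => by ring

lemma sum_Φp_mul_conj (S : Model P M K N τp p) (k k' : Fin K) :
    ∑ t, S.Φp t k * conj (S.Φp t k') = if k = k' then 1 else 0 := by
  have h := congrFun (congrFun S.Φp_orthonormal k') k
  rw [mul_apply, one_apply] at h
  simp only [conjTranspose_apply] at h
  simp_rw [eq_comm (a := k), ← h]
  exact Finset.sum_congr rfl fun t _ => mul_comm _ _

/-- Different antennas share no source, and for different users the noise parts are uncorrelated
because the pilots are orthonormal. The coefficients stay free so that both the estimation error and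
the normalized estimate are covered. -/
lemma cov_coeffU (S : Model P M K N τp p) (x y x' y' : Fin K → ℝ) (q q' : Fin M × Fin K) :
    ∑ j, S.coeffU x y q j * conj (S.coeffU x' y' q' j) * S.sourceVar j =
      if q = q' then ((x q.2 * x' q.2 + y q.2 * y' q.2 * p.σC2 : ℝ) : ℂ) else 0 := by
  have h : ∑ t, (y q.2 : ℂ) * S.Φp t q.2 * conj ((y' q'.2 : ℂ) * S.Φp t q'.2) * p.σC2 =
      y q.2 * y' q'.2 * p.σC2 * if q.2 = q'.2 then 1 else 0 := by
    rw [← S.sum_Φp_mul_conj, Finset.mul_sum]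
    refine Finset.sum_congr rfl fun t _ => ?_
    rw [map_mul, Complex.conj_ofReal]; ring
  obtain ⟨i, k⟩ := q
  obtain ⟨i', k'⟩ := q'
  by_cases hi : i = i'
  · subst hi
    simp only [coeffU, sourceVar, Fintype.sum_sum_type, of_apply, Sum.elim_inl, Sum.elim_inr,
      Fintype.sum_prod_type, ite_mul, zero_mul, Finset.sum_ite_irrel, Finset.sum_const_zero,
      Finset.sum_ite_eq', Finset.mem_univ, if_true, Prod.ext_iff, ite_and, zero_add,
      apply_ite conj, map_zero, mul_ite, mul_zero, h]
    by_cases hk : k = k'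
    · subst hk
      simp
    · simp [hk, Ne.symm hk]
  · simp only [coeffU, sourceVar, Fintype.sum_sum_type, of_apply, Sum.elim_inl, Sum.elim_inr,
      Fintype.sum_prod_type, ite_mul, zero_mul, Finset.sum_ite_irrel, Finset.sum_const_zero,
      Finset.sum_ite_eq', Finset.mem_univ, if_true, Prod.ext_iff, ite_and, zero_add,
      apply_ite conj, map_zero, mul_ite, mul_zero]
    simp [Ne.symm hi, hi]

/-- At a common antenna the covariance is `Φp t k` times the left side of `hxy`, so one scalar
equation per user handles all pilot symbols. The radar does not contribute, since `coeffU` has no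
`R` part. -/
lemma cov_coeffU_coeffY (S : Model P M K N τp p) (x y : Fin K → ℝ)
    (hxy : ∀ k, x k * (√(τp * p.ρu) * √(p.β k)) + y k * p.σC2 = 0)
    (q : Fin M × Fin K) (q' : Fin M × Fin τp) :
    ∑ j, S.coeffU x y q j * conj (S.coeffY q' j) * S.sourceVar j = 0 := by
  obtain ⟨i, k⟩ := q
  obtain ⟨i', t⟩ := q'
  have hxy' : (x k : ℂ) * (√(τp * p.ρu) * √(p.β k)) + y k * p.σC2 = 0 := by exact_mod_cast hxy k
  by_cases hi : i = i'
  · subst hi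
    simp only [coeffU, coeffY, sourceVar, Fintype.sum_sum_type, of_apply, Sum.elim_inl, Sum.elim_inr,
      Fintype.sum_prod_type, ite_mul, zero_mul, Finset.sum_ite_irrel, Finset.sum_const_zero,
      Finset.sum_ite_eq', Finset.mem_univ, if_true, Prod.ext_iff, ite_and, zero_add,
      apply_ite conj, map_zero, mul_ite, mul_zero, map_mul, Complex.conj_ofReal, Complex.conj_conj,
      map_one, Complex.ofReal_one]
    linear_combination S.Φp t k * hxy'
  · simp only [coeffU, coeffY, sourceVar, Fintype.sum_sum_type, of_apply, Sum.elim_inl, Sum.elim_inr,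
      Fintype.sum_prod_type, ite_mul, zero_mul, Finset.sum_ite_irrel, Finset.sum_const_zero,
      Finset.sum_ite_eq', Finset.mem_univ, if_true, Prod.ext_iff, ite_and, zero_add,
      apply_ite conj, map_zero, mul_ite, mul_zero]
    simp [Ne.symm hi]

/-- Despreading: `Φrᴴ Φp = 0` removes the radar signal and `Φpᴴ Φp = 1` isolates each user. -/
lemma Y_mul_Φp (S : Model P M K N τp p) (ω : Ω) (i : Fin M) (k : Fin K) :
    (S.Y ω * S.Φp) i k =
      (√(τp * p.ρu) * √(p.β k) : ℝ) * S.Z ω i k + (S.W ω * S.Φp) i k := by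
  have h : S.Y ω * S.Φp = (√(τp * p.ρu) : ℂ) • S.G ω + S.W ω * S.Φp := by
    simp only [Y, Matrix.add_mul, Matrix.smul_mul, Matrix.mul_assoc, S.Φr_Φp_orthogonal,
      S.Φp_orthonormal, Matrix.mul_zero, smul_zero, zero_add, Matrix.mul_one]
  rw [h]
  simp [G]
  ring

end Model

/-! ### Scalar identities for the MMSE filter. -/

section Params

variable {K : ℕ} (p : Params K) (τp : ℕ) (k : Fin K)

/-- The factor by which the linear MMSE filter scales the despread pilot signal. -/
def Params.filterGain : ℝ := √(τp * p.ρu) * p.β k / (τp * p.ρu * p.β k + p.σC2)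

lemma Params.denom_pos : 0 < τp * p.ρu * p.β k + p.σC2 := by
  have := p.ρu_pos; have := p.β_pos k; have := p.σC2_pos
  positivity

lemma Params.sq_sqrt_pilotPower : √(τp * p.ρu) ^ 2 = τp * p.ρu :=
  Real.sq_sqrt (mul_nonneg (Nat.cast_nonneg _) p.ρu_pos.le)

lemma Params.sq_sqrt_β : √(p.β k) ^ 2 = p.β k := Real.sq_sqrt (p.β_pos k).le

variable {τp} in
lemma Params.γ_pos (hτ : 0 < τp) : 0 < p.γ τp k := by
  have := p.ρu_pos; have := p.β_pos k; have := p.denom_pos τp k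
  unfold Params.γ
  positivity

/-- The normal equation characterizing the filter gain, in the form of the hypothesis `hxy` of
`cov_coeffU_coeffY`. -/
lemma Params.error_orthogonal :
    (√(p.β k) - p.filterGain τp k * (√(τp * p.ρu) * √(p.β k))) * (√(τp * p.ρu) * √(p.β k)) +
      -p.filterGain τp k * p.σC2 = 0 := by
  have hD := (p.denom_pos τp k).ne'
  have h1 := p.sq_sqrt_pilotPower τp
  have h2 := p.sq_sqrt_β k
  unfold Params.filterGain
  obtain ⟨D, hDef⟩ : ∃ D, D = τp * p.ρu * p.β k + p.σC2 := ⟨_, rfl⟩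
  rw [← hDef] at hD ⊢
  -- Eliminating the noise power in favour of the denominator `D` leaves a rational identity in `D`
  -- and the two square roots.
  have hσ : p.σC2 = D - √(τp * p.ρu) ^ 2 * √(p.β k) ^ 2 := by rw [h1, h2, hDef]; ring
  generalize √(τp * p.ρu) = s at h1 hσ ⊢
  generalize √(p.β k) = b at h2 hσ ⊢
  rw [hσ, ← h2]
  field_simp
  ring

lemma Params.error_variance :
    (√(p.β k) - p.filterGain τp k * (√(τp * p.ρu) * √(p.β k))) *
        (√(p.β k) - p.filterGain τp k * (√(τp * p.ρu) * √(p.β k))) +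
      -p.filterGain τp k * -p.filterGain τp k * p.σC2 = p.β k - p.γ τp k := by
  have hD := (p.denom_pos τp k).ne'
  have h1 := p.sq_sqrt_pilotPower τp
  have h2 := p.sq_sqrt_β k
  unfold Params.filterGain Params.γ
  obtain ⟨D, hDef⟩ : ∃ D, D = τp * p.ρu * p.β k + p.σC2 := ⟨_, rfl⟩
  rw [← hDef] at hD ⊢
  have hσ : p.σC2 = D - √(τp * p.ρu) ^ 2 * √(p.β k) ^ 2 := by rw [h1, h2, hDef]; ring
  generalize √(τp * p.ρu) = s at h1 hσ ⊢
  generalize √(p.β k) = b at h2 hσ ⊢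
  rw [hσ, ← h1, ← h2]
  field_simp
  ring

lemma Params.estimate_variance :
    (p.filterGain τp k * (√(τp * p.ρu) * √(p.β k))) *
        (p.filterGain τp k * (√(τp * p.ρu) * √(p.β k))) +
      p.filterGain τp k * p.filterGain τp k * p.σC2 = p.γ τp k := by
  have hD := (p.denom_pos τp k).ne'
  have h1 := p.sq_sqrt_pilotPower τp
  have h2 := p.sq_sqrt_β k
  unfold Params.filterGain Params.γ
  obtain ⟨D, hDef⟩ : ∃ D, D = τp * p.ρu * p.β k + p.σC2 := ⟨_, rfl⟩
  rw [← hDef] at hD ⊢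
  have hσ : p.σC2 = D - √(τp * p.ρu) ^ 2 * √(p.β k) ^ 2 := by rw [h1, h2, hDef]; ring
  generalize √(τp * p.ρu) = s at h1 hσ ⊢
  generalize √(p.β k) = b at h2 hσ ⊢
  rw [hσ, ← h1, ← h2]
  field_simp
  ring

end Params

/-! ### The linear MMSE estimate and its normalization. -/

namespace Model

variable {Ω : Type*} [MeasurableSpace Ω] {P : Measure Ω} {M K N τp : ℕ} {p : Params K}

/-- The linear MMSE estimate of the channel, as a function of the observation. -/
def linEstimate (S : Model P M K N τp p) (y : Fin M → Fin τp → ℂ) : Matrix (Fin M) (Fin K) ℂ :=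
  Matrix.of fun i k => (p.filterGain τp k : ℂ) * ∑ t, y i t * S.Φp t k

/-- The error of the linear MMSE estimate. -/
def estError (S : Model P M K N τp p) (ω : Ω) : Matrix (Fin M) (Fin K) ℂ :=
  S.G ω - S.linEstimate (S.Y ω)

lemma linEstimate_apply (S : Model P M K N τp p) (ω : Ω) (i : Fin M) (k : Fin K) :
    S.linEstimate (S.Y ω) i k = ∑ j,
      S.coeffU (fun k => p.filterGain τp k * (√(τp * p.ρu) * √(p.β k))) (p.filterGain τp) (i, k) j *
        S.source j ω := by
  rw [sum_coeffU]
  have h := S.Y_mul_Φp ω i k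
  rw [mul_apply] at h
  simp only [linEstimate, of_apply, h]
  push_cast
  ring

lemma estError_apply (S : Model P M K N τp p) (ω : Ω) (i : Fin M) (k : Fin K) :
    S.estError ω i k = ∑ j,
      S.coeffU (fun k => √(p.β k) - p.filterGain τp k * (√(τp * p.ρu) * √(p.β k)))
        (fun k => -p.filterGain τp k) (i, k) j * S.source j ω := by
  rw [estError, Matrix.sub_apply, linEstimate_apply, sum_coeffU, sum_coeffU]
  simp only [G, of_apply]
  push_cast
  ring

lemma measurable_linEstimate (S : Model P M K N τp p) (i : Fin M) (k : Fin K) :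
    Measurable fun y => S.linEstimate y i k := by
  simp only [linEstimate, of_apply]
  fun_prop

/-- The normal equations make the error uncorrelated with the observation, and Gaussianity upgrades
this to independence. Uncorrelatedness would not suffice, because the precoder depends nonlinearly
on all of `Y`. -/
lemma indepFun_estError_Y (S : Model P M K N τp p) :
    IndepFun (fun ω (q : Fin M × Fin K) => S.estError ω q.1 q.2)
      (fun ω (i : Fin M) (t : Fin τp) => S.Y ω i t) P := by
  have h := indepFun_linearForms S.hasLaw_source S.sourceVar_nonneg S.iIndepFun_source _ S.coeffY
    (S.cov_coeffU_coeffY (fun k => √(p.β k) - p.filterGain τp k * (√(τp * p.ρu) * √(p.β k)))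
      (fun k => -p.filterGain τp k) (p.error_orthogonal τp))
  simp_rw [sum_coeffY] at h
  simp_rw [estError_apply]
  let φ : (Fin M × Fin τp → ℂ) → Fin M → Fin τp → ℂ := fun x i t => x (i, t)
  have hφ : Measurable φ :=
    measurable_pi_lambda _ fun i => measurable_pi_lambda _ fun t => measurable_pi_apply _
  exact h.comp measurable_id hφ

lemma memLp_estError (S : Model P M K N τp p) (i : Fin M) (k : Fin K) :
    MemLp (fun ω => S.estError ω i k) 2 P := by
  simp_rw [estError_apply]
  exact memLp_linearForm S.hasLaw_source _

lemma memLp_linEstimate (S : Model P M K N τp p) (i : Fin M) (k : Fin K) :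
    MemLp (fun ω => S.linEstimate (S.Y ω) i k) 2 P := by
  simp_rw [linEstimate_apply]
  exact memLp_linearForm S.hasLaw_source _

lemma integral_estError [IsProbabilityMeasure P] (S : Model P M K N τp p) (i : Fin M) (k : Fin K) :
    ∫ ω, S.estError ω i k ∂P = 0 := by
  simp_rw [estError_apply]
  exact integral_linearForm S.hasLaw_source _

lemma integral_estError_mul_conj (S : Model P M K N τp p) (i i' : Fin M) (k : Fin K) :
    ∫ ω, S.estError ω i k * conj (S.estError ω i' k) ∂P =
      if i = i' then ((p.β k - p.γ τp k : ℝ) : ℂ) else 0 := by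
  simp_rw [estError_apply]
  rw [integral_linearForm_mul_conj S.hasLaw_source S.sourceVar_nonneg S.iIndepFun_source,
    cov_coeffU, p.error_variance]
  simp

/-- Replaces the variational definition of the estimate by a formula: channel = linear estimate +
independent centred error. -/
lemma ae_eq_linEstimate [IsProbabilityMeasure P] (S : Model P M K N τp p)
    {Ghat : Ω → Matrix (Fin M) (Fin K) ℂ} (hGhat : S.IsChannelEstimate Ghat) :
    ∀ᵐ ω ∂P, Ghat ω = S.linEstimate (S.Y ω) := by
  have h : ∀ i k, ∀ᵐ ω ∂P, Ghat ω i k = S.linEstimate (S.Y ω) i k := fun i k =>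
    (hGhat i k).ae_eq (S.measurable_linEstimate i k) (S.memLp_linEstimate i k)
      (S.memLp_estError i k) (S.integral_estError i k)
      (S.indepFun_estError_Y.comp (measurable_pi_apply (i, k)) measurable_id)
      fun ω => by
        change S.G ω i k = S.linEstimate (S.Y ω) i k + S.estError ω i k
        rw [estError, Matrix.sub_apply]; ring
  filter_upwards [ae_all_iff.2 fun i => ae_all_iff.2 (h i)] with ω hω
  ext i k
  exact hω i k

/-- The normalized linear MMSE estimate, as a function of the observation. -/
def normEstimate (S : Model P M K N τp p) (y : Fin M → Fin τp → ℂ) : Matrix (Fin M) (Fin K) ℂ :=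
  normalizedEstimate (p.γ τp) (S.linEstimate y)

lemma normEstimate_apply (S : Model P M K N τp p) (ω : Ω) (i : Fin M) (k : Fin K) :
    S.normEstimate (S.Y ω) i k = ∑ j,
      S.coeffU (fun k => p.filterGain τp k * (√(τp * p.ρu) * √(p.β k)) / √(p.γ τp k))
        (fun k => p.filterGain τp k / √(p.γ τp k)) (i, k) j * S.source j ω := by
  simp only [normEstimate, normalizedEstimate, of_apply, linEstimate_apply, sum_coeffU]
  push_cast
  ring

lemma cov_normEstimate (S : Model P M K N τp p) (hτ : 0 < τp) (q q' : Fin M × Fin K) :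
    ∑ j, S.coeffU (fun k => p.filterGain τp k * (√(τp * p.ρu) * √(p.β k)) / √(p.γ τp k))
        (fun k => p.filterGain τp k / √(p.γ τp k)) q j *
      conj (S.coeffU (fun k => p.filterGain τp k * (√(τp * p.ρu) * √(p.β k)) / √(p.γ τp k))
        (fun k => p.filterGain τp k / √(p.γ τp k)) q' j) * S.sourceVar j =
      if q = q' then ((1 : ℝ) : ℂ) else 0 := by
  rw [cov_coeffU]
  congr 2
  have h := p.estimate_variance τp q.2
  have hγ := p.γ_pos q.2 hτ
  have hs : √(p.γ τp q.2) ≠ 0 := (Real.sqrt_pos.2 hγ).ne'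
  have hs2 : √(p.γ τp q.2) ^ 2 = p.γ τp q.2 := Real.sq_sqrt hγ.le
  rw [← hs2] at h
  field_simp
  linear_combination h

lemma hasLaw_conj_normEstimate (S : Model P M K N τp p) (hτ : 0 < τp) (i : Fin M) (k : Fin K) :
    HasLaw (fun ω => (S.normEstimate (S.Y ω)).map star i k) (complexGaussian 1) P := by
  have h : HasLaw (fun ω => S.normEstimate (S.Y ω) i k) (complexGaussian 1) P := by
    simp_rw [normEstimate_apply]
    exact hasLaw_linearForm S.hasLaw_source S.sourceVar_nonneg S.iIndepFun_source _
      (by rw [S.cov_normEstimate hτ, if_pos rfl])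
  exact hasLaw_conj h zero_le_one

lemma iIndepFun_conj_normEstimate (S : Model P M K N τp p) (hτ : 0 < τp) :
    iIndepFun (fun (q : Fin M × Fin K) ω => (S.normEstimate (S.Y ω)).map star q.1 q.2) P := by
  have h : iIndepFun (fun (q : Fin M × Fin K) ω => S.normEstimate (S.Y ω) q.1 q.2) P := by
    simp_rw [normEstimate_apply]
    exact iIndepFun_linearForms S.hasLaw_source S.sourceVar_nonneg S.iIndepFun_source _
      fun q q' hq => by rw [S.cov_normEstimate hτ, if_neg hq]
  exact h.comp (fun _ => conj) fun _ => Complex.continuous_conj.measurable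

end Model

/-! ### Algebra of the zero-forcing precoder. -/

section ZeroForcing

variable {M K : ℕ}

lemma transpose_mul_map_star (H : Matrix (Fin M) (Fin K) ℂ) :
    Hᵀ * H.map star = (H.map star)ᴴ * H.map star := by
  congr 1
  ext i j
  simp

lemma transpose_mul_zfPrecoder {H : Matrix (Fin M) (Fin K) ℂ} (hH : IsUnit (Hᵀ * H.map star)) :
    Hᵀ * zfPrecoder H = (√((M : ℝ) - K) : ℂ) • (1 : Matrix (Fin K) (Fin K) ℂ) := by
  rw [zfPrecoder, Matrix.mul_smul, ← Matrix.mul_assoc,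
    mul_nonsing_inv _ ((isUnit_iff_isUnit_det _).1 hH)]

/-- With `B = H^*` the precoder is `√(M-K) B(BᴴB)⁻¹`, so its own Gram matrix collapses to
`(M-K)(BᴴB)⁻¹`. -/
lemma sum_norm_sq_zfPrecoder (hKM : K < M) {H : Matrix (Fin M) (Fin K) ℂ}
    (hH : IsUnit (Hᵀ * H.map star)) (k : Fin K) :
    ∑ i, ‖zfPrecoder H i k‖ ^ 2 =
      ((M : ℝ) - K) * (((H.map star)ᴴ * H.map star)⁻¹ k k).re := by
  have hMK : 0 ≤ (M : ℝ) - K := sub_nonneg.2 (by exact_mod_cast hKM.le)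
  have hd := (isUnit_iff_isUnit_det _).1 hH
  rw [transpose_mul_map_star] at hd
  set B := H.map star
  have h : (zfPrecoder H)ᴴ * zfPrecoder H = (((M : ℝ) - K : ℝ) : ℂ) • (Bᴴ * B)⁻¹ := by
    rw [zfPrecoder, transpose_mul_map_star, conjTranspose_smul, conjTranspose_mul,
      conjTranspose_nonsing_inv, conjTranspose_mul, conjTranspose_conjTranspose,
      Matrix.smul_mul, Matrix.mul_smul, smul_smul]
    have e1 : (Bᴴ * B)⁻¹ * Bᴴ * (B * (Bᴴ * B)⁻¹) = (Bᴴ * B)⁻¹ := by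
      rw [Matrix.mul_assoc, ← Matrix.mul_assoc Bᴴ, ← Matrix.mul_assoc, nonsing_inv_mul _ hd,
        Matrix.one_mul]
    rw [e1, Complex.star_def, Complex.conj_ofReal, ← Complex.ofReal_mul,
      Real.mul_self_sqrt hMK]
  have h2 := congrFun (congrFun h k) k
  rw [mul_apply, Matrix.smul_apply, smul_eq_mul] at h2
  have h3 : ((∑ i, ‖zfPrecoder H i k‖ ^ 2 : ℝ) : ℂ) =
      (((M : ℝ) - K : ℝ) : ℂ) * (Bᴴ * B)⁻¹ k k := by
    rw [← h2]; push_cast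
    exact Finset.sum_congr rfl fun i _ => by
      rw [conjTranspose_apply, Complex.star_def, Complex.conj_mul']
  have h4 := congrArg Complex.re h3
  rwa [Complex.ofReal_re, Complex.re_ofReal_mul] at h4

end ZeroForcing

/-! ### Moments of the precoder, the effective gains and the interference; the SINR. -/

namespace Model

variable {Ω : Type*} [MeasurableSpace Ω] {P : Measure Ω} {M K N τp : ℕ} {p : Params K}

/-- A pilot of unit norm cannot have length zero. This makes `γ_k` positive, so that normalizing the
estimate is legitimate. -/
lemma pilotLength_pos (S : Model P M K N τp p) (k : Fin K) : 0 < τp := by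
  rcases Nat.eq_zero_or_pos τp with rfl | h
  · have := S.sum_Φp_mul_conj k k
    simp at this
  · exact h

lemma aemeasurable_Y (S : Model P M K N τp p) :
    AEMeasurable (fun ω (i : Fin M) (t : Fin τp) => S.Y ω i t) P := by
  refine aemeasurable_pi_lambda _ fun i => aemeasurable_pi_lambda _ fun t => ?_
  have h := (memLp_linearForm S.hasLaw_source (S.coeffY (i, t))).aemeasurable
  simp_rw [sum_coeffY] at h
  exact h

/-- The zero-forcing precoder, as a function of the observation. -/
def precoder (S : Model P M K N τp p) (y : Fin M → Fin τp → ℂ) : Matrix (Fin M) (Fin K) ℂ :=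
  zfPrecoder (S.normEstimate y)

lemma measurable_precoder (S : Model P M K N τp p) (i : Fin M) (k : Fin K) :
    Measurable fun y => S.precoder y i k := by
  have hH : ∀ i k, Measurable fun y => S.normEstimate y i k := fun i k => by
    simp only [normEstimate, normalizedEstimate, of_apply]
    exact (S.measurable_linEstimate i k).div_const _
  have hB : ∀ i k, Measurable fun y => (S.normEstimate y).map star i k := fun i k =>
    Complex.continuous_conj.measurable.comp (hH i k)
  simp only [precoder, zfPrecoder, Matrix.smul_apply, smul_eq_mul]
  refine Measurable.const_mul (measurable_mul_apply hB (measurable_inv_apply ?_) i k) _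
  exact measurable_mul_apply (fun i j => hH j i) hB

lemma ae_isUnit_gram_normEstimate [IsProbabilityMeasure P] (S : Model P M K N τp p) (hKM : K < M)
    (hτ : 0 < τp) :
    ∀ᵐ ω ∂P, IsUnit ((S.normEstimate (S.Y ω))ᵀ * (S.normEstimate (S.Y ω)).map star) := by
  simp_rw [transpose_mul_map_star]
  exact ae_isUnit_gram (S.hasLaw_conj_normEstimate hτ) (S.iIndepFun_conj_normEstimate hτ)
    (by simpa using hKM)

/-- The factor `√(M-K)` in the precoder exactly compensates the mean `1/(M-K)` of the inverse Gram
entry. Stating this in `[0,∞]` makes integrability a consequence of the value. -/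
lemma lintegral_sum_norm_sq_precoder [IsProbabilityMeasure P] (S : Model P M K N τp p)
    (hKM : K < M) (hτ : 0 < τp) (k : Fin K) :
    ∫⁻ ω, ENNReal.ofReal (∑ i, ‖S.precoder (S.Y ω) i k‖ ^ 2) ∂P = 1 := by
  have hMK : 0 < (M : ℝ) - K := sub_pos.2 (by exact_mod_cast hKM)
  have h := lintegral_gram_inv_apply (S.hasLaw_conj_normEstimate hτ)
    (S.iIndepFun_conj_normEstimate hτ) (by simpa using hKM) k
  have e : ∀ᵐ ω ∂P, ENNReal.ofReal (∑ i, ‖S.precoder (S.Y ω) i k‖ ^ 2) =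
      ENNReal.ofReal ((M : ℝ) - K) * ENNReal.ofReal
        (((((S.normEstimate (S.Y ω)).map star)ᴴ * (S.normEstimate (S.Y ω)).map star)⁻¹ k k).re) := by
    filter_upwards [S.ae_isUnit_gram_normEstimate hKM hτ] with ω hω
    rw [← ENNReal.ofReal_mul hMK.le, ← sum_norm_sq_zfPrecoder hKM hω]
    rfl
  rw [lintegral_congr_ae e, lintegral_const_mul' _ _ ENNReal.ofReal_ne_top, h,
    ← ENNReal.ofReal_mul hMK.le]
  simp [hMK.ne']

lemma aestronglyMeasurable_precoder (S : Model P M K N τp p) (i : Fin M) (k : Fin K) :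
    AEStronglyMeasurable (fun ω => S.precoder (S.Y ω) i k) P :=
  ((S.measurable_precoder i k).comp_aemeasurable S.aemeasurable_Y).aestronglyMeasurable

lemma integrable_sum_norm_sq_precoder [IsProbabilityMeasure P] (S : Model P M K N τp p)
    (hKM : K < M) (hτ : 0 < τp) (k : Fin K) :
    Integrable (fun ω => ∑ i, ‖S.precoder (S.Y ω) i k‖ ^ 2) P := by
  refine (lintegral_ofReal_ne_top_iff_integrable ?_ ?_).1 ?_
  · exact Finset.aestronglyMeasurable_fun_sum _ fun i _ =>
      (S.aestronglyMeasurable_precoder i k).norm.pow 2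
  · exact ae_of_all _ fun ω => Finset.sum_nonneg fun i _ => by positivity
  · rw [S.lintegral_sum_norm_sq_precoder hKM hτ]
    exact ENNReal.one_ne_top

lemma memLp_precoder [IsProbabilityMeasure P] (S : Model P M K N τp p)
    (hKM : K < M) (hτ : 0 < τp) (i : Fin M) (k : Fin K) :
    MemLp (fun ω => S.precoder (S.Y ω) i k) 2 P := by
  rw [memLp_two_iff_integrable_sq_norm (S.aestronglyMeasurable_precoder i k)]
  refine (S.integrable_sum_norm_sq_precoder hKM hτ k).mono'
    ((S.aestronglyMeasurable_precoder i k).norm.pow 2) (ae_of_all _ fun ω => ?_)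
  rw [Real.norm_of_nonneg (by positivity)]
  exact Finset.single_le_sum (f := fun i => ‖S.precoder (S.Y ω) i k‖ ^ 2)
    (fun i _ => by positivity) (Finset.mem_univ i)

lemma sum_integral_norm_sq_precoder [IsProbabilityMeasure P] (S : Model P M K N τp p)
    (hKM : K < M) (hτ : 0 < τp) (k : Fin K) :
    ∑ i, ∫ ω, ‖S.precoder (S.Y ω) i k‖ ^ 2 ∂P = 1 := by
  rw [← integral_finsetSum _ fun i _ => integrable_norm_sq (S.memLp_precoder hKM hτ i k),
    integral_eq_lintegral_of_nonneg_ae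
      (ae_of_all _ fun ω => Finset.sum_nonneg fun i _ => by positivity)
      (S.integrable_sum_norm_sq_precoder hKM hτ k).aestronglyMeasurable,
    S.lintegral_sum_norm_sq_precoder hKM hτ, ENNReal.toReal_one]

/-- The part of the effective gain that is due to the estimation error. -/
def errorGain (S : Model P M K N τp p) (k k' : Fin K) (ω : Ω) : ℂ :=
  ∑ i, S.estError ω i k * S.precoder (S.Y ω) i k'

lemma indepFun_estError_precoder (S : Model P M K N τp p) (k k' : Fin K) :
    IndepFun (fun ω i => S.estError ω i k) (fun ω i => S.precoder (S.Y ω) i k') P := by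
  have h1 : Measurable fun (x : Fin M × Fin K → ℂ) i => x (i, k) :=
    measurable_pi_lambda _ fun i => measurable_pi_apply _
  have h2 : Measurable fun y i => S.precoder y i k' :=
    measurable_pi_lambda _ fun i => S.measurable_precoder i k'
  exact S.indepFun_estError_Y.comp h1 h2

section ErrorGain

variable [IsProbabilityMeasure P]

lemma memLp_errorGain (S : Model P M K N τp p) (hKM : K < M) (hτ : 0 < τp)
    (k k' : Fin K) :
    MemLp (S.errorGain k k') 2 P :=
  memLp_sum_mul (fun i => S.memLp_estError i k) (fun i => S.memLp_precoder hKM hτ i k')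
    (S.indepFun_estError_precoder k k')

lemma integral_errorGain (S : Model P M K N τp p) (hKM : K < M) (hτ : 0 < τp)
    (k k' : Fin K) :
    ∫ ω, S.errorGain k k' ω ∂P = 0 :=
  integral_sum_mul (fun i => S.memLp_estError i k) (fun i => S.memLp_precoder hKM hτ i k')
    (fun i => S.integral_estError i k) (S.indepFun_estError_precoder k k')

lemma integral_norm_sq_errorGain (S : Model P M K N τp p) (hKM : K < M) (hτ : 0 < τp)
    (k k' : Fin K) :
    ∫ ω, ‖S.errorGain k k' ω‖ ^ 2 ∂P = p.β k - p.γ τp k := by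
  have h := integral_norm_sum_mul_sq (fun i => S.memLp_estError i k)
    (fun i => S.memLp_precoder hKM hτ i k') (fun i j => S.integral_estError_mul_conj i j k)
    (S.indepFun_estError_precoder k k')
  rw [S.sum_integral_norm_sq_precoder hKM hτ, mul_one] at h
  exact h

/-- Zero forcing removes the interference of the estimated channels. -/
lemma ae_gain_eq (S : Model P M K N τp p) (hKM : K < M) (hτ : 0 < τp)
    (k k' : Fin K)
    {T : Ω → Matrix (Fin M) (Fin K) ℂ}
    (hT : ∀ᵐ ω ∂P, T ω = S.precoder (S.Y ω)) :
    ∀ᵐ ω ∂P, S.gain T k k' ω =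
      (if k = k' then (√(((M : ℝ) - K) * p.γ τp k) : ℂ) else 0) + S.errorGain k k' ω := by
  have hMK : 0 ≤ (M : ℝ) - K := sub_nonneg.2 (by exact_mod_cast hKM.le)
  filter_upwards [hT, S.ae_isUnit_gram_normEstimate hKM hτ] with ω h1 h2
  have h3 : ((S.normEstimate (S.Y ω))ᵀ * S.precoder (S.Y ω)) k k' =
      ((√((M : ℝ) - K) : ℂ) • (1 : Matrix (Fin K) (Fin K) ℂ)) k k' :=
    congrFun (congrFun (transpose_mul_zfPrecoder h2) k) k'
  have hγ : (√(p.γ τp k) : ℂ) ≠ 0 := by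
    exact_mod_cast (Real.sqrt_pos.2 (p.γ_pos k hτ)).ne'
  -- The estimated part meets the precoder only through `Hᵀ T`, which is a multiple of the identity;
  -- the error part is left as it is.
  have h4 : ∀ i, S.G ω i k =
      √(p.γ τp k) * S.normEstimate (S.Y ω) i k + S.estError ω i k := fun i => by
    simp only [normEstimate, normalizedEstimate, of_apply, estError, Matrix.sub_apply]
    field_simp
    ring
  rw [gain, h1, mul_apply]
  simp only [transpose_apply, h4, add_mul, Finset.sum_add_distrib, mul_assoc]
  rw [← Finset.mul_sum]
  rw [mul_apply] at h3
  simp only [transpose_apply] at h3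
  rw [h3, Matrix.smul_apply, one_apply, Real.sqrt_mul hMK]
  congr 1
  split_ifs <;> simp [mul_comm]

lemma memLp_gain (S : Model P M K N τp p) (hKM : K < M) {T : Ω → Matrix (Fin M) (Fin K) ℂ}
    (hT : ∀ᵐ ω ∂P, T ω = S.precoder (S.Y ω)) (k k' : Fin K) : MemLp (S.gain T k k') 2 P := by
  have hτ := S.pilotLength_pos k
  obtain ⟨c, hc⟩ : ∃ c : ℂ, ∀ᵐ ω ∂P, S.gain T k k' ω = c + S.errorGain k k' ω :=
    ⟨_, S.ae_gain_eq hKM hτ k k' hT⟩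
  have h : MemLp (fun ω => c + S.errorGain k k' ω) 2 P :=
    (memLp_const c).add (S.memLp_errorGain hKM hτ k k')
  exact MemLp.ae_eq (Filter.EventuallyEq.symm hc) h

end ErrorGain

section Radar

lemma memLp_radarInterference (S : Model P M K N τp p) (k : Fin K) :
    MemLp (S.radarInterference k) 2 P :=
  (memLp_sum_mul (fun i => memLp_of_hasLaw (S.hasLaw_F i k)) S.memLp_s (S.indep_F_s k)).const_mul _

lemma integral_norm_sq_radarInterference (S : Model P M K N τp p) (k : Fin K) :
    ∫ ω, ‖S.radarInterference k ω‖ ^ 2 ∂P = p.PR * p.βbar k * N := by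
  have hF : ∀ i j, ∫ ω, S.F ω i k * conj (S.F ω j k) ∂P =
      if i = j then (p.βbar k : ℂ) else 0 := fun i j => by
    -- Single entries are linear forms with unit-vector coefficients, so the general covariance
    -- formula applies.
    have h := integral_linearForm_mul_conj (fun i => S.hasLaw_F i k) (fun _ => p.βbar_nonneg k)
      (S.indep_F k) (Pi.single i 1) (Pi.single j 1)
    simpa [Pi.single_apply, apply_ite conj, eq_comm (a := j)] using h
  have hs : ∀ i, ∫ ω, ‖S.s ω i‖ ^ 2 ∂P = 1 := fun i => by
    have h := S.cov_s i i
    rw [if_pos rfl] at h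
    have h2 := ofReal_integral_norm_sq (P := P) (fun ω => S.s ω i)
    rw [show (∫ ω, S.s ω i * conj (S.s ω i) ∂P) = 1 from h] at h2
    exact_mod_cast h2
  have h := integral_norm_sum_mul_sq (fun i => memLp_of_hasLaw (S.hasLaw_F i k)) S.memLp_s hF
    (S.indep_F_s k)
  simp only [hs, Finset.sum_const, Finset.card_univ, Fintype.card_fin, nsmul_eq_mul, mul_one] at h
  simp only [radarInterference, norm_mul, mul_pow]
  rw [integral_const_mul, h, Complex.norm_real, Real.norm_eq_abs, sq_abs,
    Real.sq_sqrt p.PR_nonneg, mul_assoc]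

lemma integral_norm_sq_noise (S : Model P M K N τp p) (k : Fin K) :
    ∫ ω, ‖S.n ω k‖ ^ 2 ∂P = p.σC2 := by
  have h := ofReal_integral_norm_sq (P := P) (fun ω => S.n ω k)
  rw [integral_mul_conj_of_hasLaw (S.hasLaw_n k) p.σC2_pos.le] at h
  exact_mod_cast h

end Radar

lemma SINR_eq [IsProbabilityMeasure P] (S : Model P M K N τp p) (hKM : K < M)
    {T : Ω → Matrix (Fin M) (Fin K) ℂ} (hT : ∀ᵐ ω ∂P, T ω = S.precoder (S.Y ω)) (k : Fin K) :
    S.SINR T k = ((M : ℝ) - K) * p.ρ * p.γ τp k * p.η k /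
      (p.ρ * (p.β k - p.γ τp k) * ∑ k', p.η k' + p.PR * p.βbar k * N + p.σC2) := by
  have hτ := S.pilotLength_pos k
  have hMK : 0 ≤ (M : ℝ) - K := sub_nonneg.2 (by exact_mod_cast hKM.le)
  have hsq : ∀ (x : ℝ), 0 ≤ x → ‖(√x : ℂ)‖ ^ 2 = x := fun x hx => by
    rw [Complex.norm_real, Real.norm_eq_abs, sq_abs, Real.sq_sqrt hx]
  have hρη : ∀ k', 0 ≤ p.ρ * p.η k' := fun k' => mul_nonneg p.ρ_nonneg (p.η_nonneg k')
  have hmean : ∫ ω, S.gain T k k ω ∂P = (√(((M : ℝ) - K) * p.γ τp k) : ℂ) := by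
    rw [integral_congr_ae (S.ae_gain_eq hKM hτ k k hT), integral_add (integrable_const _)
      ((S.memLp_errorGain hKM hτ k k).integrable (by norm_num)),
      S.integral_errorGain hKM hτ, integral_const]
    simp
  have hDS : ‖S.DS T k‖ ^ 2 = p.ρ * p.η k * (((M : ℝ) - K) * p.γ τp k) := by
    rw [DS, hmean, norm_mul, mul_pow, hsq _ (hρη k), hsq _ (mul_nonneg hMK (p.γ_pos k hτ).le)]
  have hBU : ∫ ω, ‖S.BU T k ω‖ ^ 2 ∂P = p.ρ * p.η k * (p.β k - p.γ τp k) := by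
    rw [← S.integral_norm_sq_errorGain hKM hτ k k, ← integral_const_mul]
    refine integral_congr_ae ?_
    filter_upwards [S.ae_gain_eq hKM hτ k k hT] with ω hω
    rw [BU, hmean, hω, if_pos rfl, add_sub_cancel_left, norm_mul, mul_pow, hsq _ (hρη k)]
  have hIUI : ∀ k' ∈ Finset.univ.erase k, ∫ ω, ‖S.IUI T k k' ω‖ ^ 2 ∂P =
      p.ρ * p.η k' * (p.β k - p.γ τp k) := fun k' hk' => by
    rw [← S.integral_norm_sq_errorGain hKM hτ k k', ← integral_const_mul]
    refine integral_congr_ae ?_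
    filter_upwards [S.ae_gain_eq hKM hτ k k' hT] with ω hω
    rw [IUI, hω, if_neg (Finset.ne_of_mem_erase hk').symm, zero_add, norm_mul, mul_pow,
      hsq _ (hρη k')]
  -- The beamforming uncertainty has the same shape as the interference terms and supplies the
  -- missing index `k' = k`, completing the sum over all users.
  rw [SINR, hDS, hBU, Finset.sum_congr rfl hIUI, S.integral_norm_sq_radarInterference,
    S.integral_norm_sq_noise,
    Finset.add_sum_erase Finset.univ (fun k' => p.ρ * p.η k' * (p.β k - p.γ τp k))
      (Finset.mem_univ k), ← Finset.sum_mul, ← Finset.mul_sum]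
  congr 1 <;> ring

end Model

end MassiveMIMORadar

end

theorem proposition2 {Ω : Type*} [MeasurableSpace Ω] (P : MeasureTheory.Measure Ω)
    [MeasureTheory.IsProbabilityMeasure P] (M K N τp τ : ℕ) (hKM : K < M) (hτ : τp ≤ τ)
    (p : MassiveMIMORadar.Params K) (S : MassiveMIMORadar.Model P M K N τp p)
    (Ghat H T : Ω → Matrix (Fin M) (Fin K) ℂ)
    (hGhat : S.IsChannelEstimate Ghat)
    (hH : ∀ ω, H ω = MassiveMIMORadar.normalizedEstimate (p.γ τp) (Ghat ω))
    (hT : ∀ ω, T ω = MassiveMIMORadar.zfPrecoder (H ω)) (k : Fin K) :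
    -- the precoder and all the second moments that enter the SE are well defined
    (∀ᵐ ω ∂P, IsUnit ((H ω)ᵀ * (H ω).map star)) ∧
    (∀ k', MeasureTheory.MemLp (S.gain T k k') 2 P) ∧
    MeasureTheory.MemLp (S.radarInterference k) 2 P ∧
    MeasureTheory.MemLp (fun ω => S.n ω k) 2 P ∧
    S.SE τ T k =
      (1 - (τp : ℝ) / τ) * Real.logb 2
        (1 + ((M : ℝ) - K) * p.ρ * p.γ τp k * p.η k /
          (p.ρ * (p.β k - p.γ τp k) * ∑ k', p.η k' + p.PR * p.βbar k * N + p.σC2)) := by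
  have hτp := S.pilotLength_pos k
  -- Only almost sure equality is available, since MMSE estimates are unique up to null sets. It
  -- suffices, because the precoder enters the claims only through integrals, `L²` membership and
  -- almost sure statements.
  have hH' : ∀ᵐ ω ∂P, H ω = S.normEstimate (S.Y ω) := by
    filter_upwards [S.ae_eq_linEstimate hGhat] with ω hω
    rw [hH, hω]
    rfl
  have hT' : ∀ᵐ ω ∂P, T ω = S.precoder (S.Y ω) := by
    filter_upwards [hH'] with ω hω
    rw [hT, hω]
    rfl
  refine ⟨?_, fun k' => ?_, S.memLp_radarInterference k,
    MassiveMIMORadar.memLp_of_hasLaw (S.hasLaw_n k), ?_⟩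
  · filter_upwards [hH', S.ae_isUnit_gram_normEstimate hKM hτp] with ω h1 h2
    rwa [h1]
  · exact S.memLp_gain hKM hT' k k'
  · rw [MassiveMIMORadar.Model.SE, S.SINR_eq hKM hT']
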